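/- **Setting.** All systems are finite-dimensional. For $n\ge 1$ let $X=\sum_{j\in\mathbb Z_n}|j+1\rangle\langle j|$ and $Z=\sum_{j\in\mathbb Z_n}e^{2\pi i j/n}|j\rangle\langle j|$ on $\mathbb C^n$. Let $d\ge 1$, let $p$ be a prime, let $C,E,I$ be $d$-dimensional systems, $K$ a $p$-dimensional system, and $|\Theta\rangle=d^{-1/2}\sum_i|ii\rangle$. A *quantum one-time table* is given by: a unitary $M:C\otimes S\to A\otimes B$ and a state $\omega_S$ whose only nonzero eigenvalue is $1/p$, with multiplicity $p$, such that $\Phi_M(\rho)=M(\rho_C\otimes\omega_S)M^\dagger$ is a universal quantum masker (the marginals of $\Phi_M(\rho)$ on $A$ and on $B$ do not depend on the state $\rho$, and $\rho$ can be recovered from $\Phi_M(\rho)$ by a quantum channel); a purification $|\Omega\rangle_{SK}$ of $\omega_S$; and a set $J\subseteq\mathbb Z_p\setminus\{0\}$ with $|J|\ge 2$. **The initializer scheme.** SETUP: a trusted initializer picks uniformly random $i=(i_1,i_2)\in\mathbb Z_p^2$ and $j=(j_1,j_2)\in J^2$, prepares $(1_E\otimes M\otimes X_K^{j_1i_1}Z_K^{j_2i_2})|\Theta\rangle_{EC}|\Omega\rangle_{SK}$,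 and gives $EA$ and $i$ to Alice, $BK$ and $j$ to Bob. COMMIT: Alice prepares a secret state $\rho$ on $I$, measures $IE$ in the basis $\{(X^aZ^b\otimes 1)|\Theta\rangle_{IE}\}_{a,b\in\mathbb Z_d}$, and announces the outcome $(a,b)$. REVEAL: Alice sends $A$ and reports indices $k=(k_1,k_2)$ (honestly $k=i$). Bob applies $Z^{-j_2k_2}X^{-j_1k_1}$ to $K$ and $M^\dagger$ to $AB$, and checks by a projective measurement that $SK$ is in the state $|\Omega\rangle$. If so, he applies $X^aZ^b$ to $C$ and accepts the state of $C$; otherwise he rejects. A general behaviour of Alice who has received $i$ consists of subchannels $\Delta^{a,b}:EA\to A'$ whose sum is a channel, $A'$ being any system (she announces $(a,b)$), followed by subchannels $\Xi^{k}:A'\to A$, $k\in\mathbb Z_p^2$, whose sum is a channel (she reports $k$ and sends $A$); reporting a fixed $k$ is the special case in which only $\Xi^k$ is nonzero. **Theorem.** The initializer qubit-commitment scheme is unconditionally secure, in the following sense. For every quantum one-time table as above: 1. (Correctness) If both parties are honest, then for all $i$, all $j\in J^2$ and every state $\rho$, each outcome $(a,b)$ occurs with probability $1/d^2$, Bob's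 check succeeds with certainty, and he accepts the state $\rho$. 2. (Perfect concealment) There is a state $\beta_B$ such that for every secret state $\rho$ and every $j\in J^2$, if Alice is honest in COMMIT, then each outcome $(a,b)$ has probability $1/d^2$, and for each outcome the state of Bob's systems $BK$ after COMMIT, averaged over the indices $i$ unknown to him, is $\beta_B\otimes 1_K/p$, which does not depend on $\rho$. 3. (Security against Alice) There are a system $S'$ and a unit vector $|\Psi\rangle_{AS'}$, depending only on the table, such that: (a) If Alice honestly commits to $\rho$, then applies any channel $\Xi$ to $A$, and reports the true indices, then for each $(a,b)$ the unnormalized accepted state is $\frac{q}{d^2}\rho$, where $q=\langle\Psi|(\Xi_A\otimes\mathrm{id}_{S'})(|\Psi\rangle\langle\Psi|)|\Psi\rangle$. (b) For every behaviour $(\Delta,\Xi)$ of Alice, all $i$, all $j\in J^2$ and every $(a,b)$, the unnormalized state accepted by Bob when Alice reports the true indices $i$ equals $$X^aZ^b\,\langle\Psi|_{AS'}\,(\Xi^{i}_{A'\to A}\circ\Delta^{a,b}_{EA\to A'})\big(|\Theta\rangle\langle\Theta|_{EC}\otimes|\Psi\rangle\langle\Psi|_{AS'}\big)\,|\Psi\rangle_{AS'}\,Z^{-b}X^{-a},$$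 the unnormalized output of the delayed quantum teleportation in which Alice and Bob share $|\Theta\rangle_{EC}$, Alice has the local ancilla $|\Psi\rangle_{AS'}$, fixes the message $(a,b)$ by applying $\Delta^{a,b}$, later applies $\Xi^i$ and finds $AS'$ in the state $|\Psi\rangle$, and Bob then receives $(a,b)$ and applies $X^aZ^b$. (c) For every behaviour of Alice and every $i$, the probability, over $j$ uniform in $J^2$, that she reports wrong indices $k\ne i$ and passes Bob's check is at most $1/|J|$. Moreover, for every $d\ge1$ the bound $1/|J|$ can be made arbitrarily small: for every $\varepsilon>0$ there are a prime $p$ and a quantum one-time table for $d$-dimensional secrets with $1/|J|<\varepsilon$. -/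

import Mathlib

open scoped Matrix Kronecker ComplexOrder

noncomputable section

namespace QC

/-! Finite-dimensional quantum systems are given by finite index types (a fixed orthonormal basis);
operators are complex matrices, and joint systems are indexed by products. -/

section General

variable {X Y R ι : Type*} [Fintype X] [Fintype Y] [Fintype R] [Fintype ι]

/-- Density operators. -/
def IsDensity (ρ : Matrix X X ℂ) : Prop := ρ.PosSemidef ∧ ρ.trace = 1

/-- The rank-one operator `|v⟩⟨v|`. -/
def dyad (v : X → ℂ) : Matrix X X ℂ := Matrix.vecMulVec v (star v)

/-- Partial trace over the left factor. -/
def ptrLeft (σ : Matrix (X × R) (X × R) ℂ) : Matrix R R ℂ :=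
  Matrix.of fun r r' => ∑ x, σ (x, r) (x, r')

/-- Partial trace over the right factor. -/
def ptrRight (σ : Matrix (X × R) (X × R) ℂ) : Matrix X X ℂ :=
  Matrix.of fun x x' => ∑ r, σ (x, r) (x', r)

/-- `Φ ⊗ id_R`: the map `Φ` applied to the left factor of a joint system. -/
def ampliate (Φ : Matrix X X ℂ →ₗ[ℂ] Matrix Y Y ℂ) (σ : Matrix (X × R) (X × R) ℂ) :
    Matrix (Y × R) (Y × R) ℂ :=
  Matrix.of fun y y' => Φ (Matrix.of fun x x' => σ (x, y.2) (x', y'.2)) y.1 y'.1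

/-- Complete positivity. -/
def IsCP (Φ : Matrix X X ℂ →ₗ[ℂ] Matrix Y Y ℂ) : Prop :=
  ∀ (n : ℕ) (σ : Matrix (X × Fin n) (X × Fin n) ℂ),
    σ.PosSemidef → (ampliate Φ σ).PosSemidef

/-- Quantum channels: completely positive trace-preserving maps. -/
def IsChannel (Φ : Matrix X X ℂ →ₗ[ℂ] Matrix Y Y ℂ) : Prop :=
  IsCP Φ ∧ ∀ ρ, (Φ ρ).trace = ρ.trace

/-- A finite family of subchannels whose sum is a quantum channel. -/
def IsInstrument (Φ : ι → (Matrix X X ℂ →ₗ[ℂ] Matrix Y Y ℂ)) : Prop :=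
  (∀ m, IsCP (Φ m)) ∧ IsChannel (∑ m, Φ m)

/-- Universal quantum maskers: both marginals of the output are the same for all input states,
and a quantum channel recovers every input state from the output. -/
def IsUniversalMasker {A B : Type*} [Fintype A] [Fintype B]
    (Φ : Matrix X X ℂ → Matrix (A × B) (A × B) ℂ) : Prop :=
  (∃ α : Matrix A A ℂ, ∀ ρ, IsDensity ρ → ptrRight (Φ ρ) = α) ∧
  (∃ β : Matrix B B ℂ, ∀ ρ, IsDensity ρ → ptrLeft (Φ ρ) = β) ∧
  (∃ U : Matrix (A × B) (A × B) ℂ →ₗ[ℂ] Matrix X X ℂ,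
    IsChannel U ∧ ∀ ρ, IsDensity ρ → U (Φ ρ) = ρ)

end General

section Pauli

variable (n : ℕ) [NeZero n]

/-- Generalized Pauli `X = ∑ⱼ |j+1⟩⟨j|`. -/
def pauliX : Matrix (ZMod n) (ZMod n) ℂ := Matrix.of fun r c => if r = c + 1 then 1 else 0

/-- Generalized Pauli `Z = ∑ⱼ exp(2πij/n) |j⟩⟨j|`. -/
def pauliZ : Matrix (ZMod n) (ZMod n) ℂ := Matrix.diagonal fun j => ZMod.stdAddChar j

variable {n}

/-- `X^a Z^b`, with exponents modulo `n`. -/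
def weyl (a b : ZMod n) : Matrix (ZMod n) (ZMod n) ℂ := pauliX n ^ a.val * pauliZ n ^ b.val

/-- The maximally entangled vector `n^{-1/2} ∑ᵢ |i i⟩`. -/
def maxEnt (v : ZMod n × ZMod n) : ℂ := if v.1 = v.2 then ((Real.sqrt n : ℝ) : ℂ)⁻¹ else 0

/-- The generalized Bell vector `(X^a Z^b ⊗ 1)|Θ⟩`. -/
def bell (a b : ZMod n) : ZMod n × ZMod n → ℂ :=
  (weyl a b ⊗ₖ (1 : Matrix (ZMod n) (ZMod n) ℂ)) *ᵥ maxEnt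

end Pauli

/-- The data defining a quantum one-time table: a masking unitary `M : C ⊗ S → A ⊗ B` for a
`d`-dimensional system `C`, its safe state, which has the single nonzero eigenvalue `1/p` with
multiplicity `p`, the safe-key state `Ω` purifying the safe state with a `p`-dimensional key system
`K`, and a set `J` of nonzero residues modulo `p` with at least two elements. -/
structure QOTT (d p : ℕ) [NeZero d] [Fact p.Prime] (A B S : Type*)
    [Fintype A] [DecidableEq A] [Fintype B] [DecidableEq B] [Fintype S] [DecidableEq S] where
  M : Matrix (A × B) (ZMod d × S) ℂ
  safe : Matrix S S ℂ
  Ω : S × ZMod p → ℂ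
  J : Finset (ZMod p)
  isometry : Mᴴ * M = 1
  coisometry : M * Mᴴ = 1
  safe_density : IsDensity safe
  safe_eigenvalues : ∀ μ : ℂ, Module.End.HasEigenvalue (Matrix.toLin' safe) μ →
    μ = 0 ∨ μ = (p : ℂ)⁻¹
  safe_degeneracy : Module.finrank ℂ
    (Module.End.eigenspace (Matrix.toLin' safe) (p : ℂ)⁻¹) = p
  masks : IsUniversalMasker fun ρ : Matrix (ZMod d) (ZMod d) ℂ => M * (ρ ⊗ₖ safe) * Mᴴ
  purifies : ptrRight (dyad Ω) = safe
  zero_notMem : (0 : ZMod p) ∉ J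
  two_le_card : 2 ≤ J.card

section Alice

variable {d : ℕ} [NeZero d] {A : Type*} [Fintype A]

/-- Alice's honest `COMMIT` operation `EA → A` for outcome `m = (a, b)`: she adjoins the secret `ρ`
in the system `I`, and projects `IE` onto the generalized Bell vector `(X^a Z^b ⊗ 1)|Θ⟩_{IE}`:
`σ ↦ ⟨bell a b|_{IE} (ρ_I ⊗ σ_{EA}) |bell a b⟩_{IE}`. -/
def honestCommit (ρ : Matrix (ZMod d) (ZMod d) ℂ) (m : ZMod d × ZMod d) :
    Matrix (ZMod d × A) (ZMod d × A) ℂ →ₗ[ℂ] Matrix A A ℂ where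
  toFun σ := Matrix.of fun α α' => ∑ x, ∑ e, ∑ x', ∑ e',
    star (bell m.1 m.2 (x, e)) * (ρ x x' * σ (e, α) (e', α')) * bell m.1 m.2 (x', e')
  map_add' σ τ := by
    ext α α'
    simp [mul_add, add_mul, Finset.sum_add_distrib]
  map_smul' c σ := by
    ext α α'
    simp only [Matrix.smul_apply, Matrix.of_apply, smul_eq_mul, RingHom.id_apply, Finset.mul_sum]
    refine Finset.sum_congr rfl fun x _ => Finset.sum_congr rfl fun e _ =>
      Finset.sum_congr rfl fun x' _ => Finset.sum_congr rfl fun e' _ => ?_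
    ring

/-- Delayed quantum teleportation. Alice and Bob share `|Θ⟩_{EC}`; Alice has a local ancilla in the
pure state `Ψ` of `A₀ ⊗ R`. She fixes the classical message `m = (a, b)` by applying to `E A₀` the
subchannel `Δ m`; later she applies the local operation `Ξ` to the output `A'`, measures her
systems `A₁ R`, and sends the message if she finds the vector `v`; then Bob applies `X^a Z^b`
to `C`. The value is the unnormalized state of `C` for the message `m`. -/
def delayedTeleportation {A₀ R A' A₁ : Type*} [Fintype R] [Fintype A₁]
    (Ψ : A₀ × R → ℂ)
    (Δ : ZMod d × ZMod d →
      (Matrix (ZMod d × A₀) (ZMod d × A₀) ℂ →ₗ[ℂ] Matrix A' A' ℂ))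
    (Ξ : Matrix A' A' ℂ →ₗ[ℂ] Matrix A₁ A₁ ℂ) (v : A₁ × R → ℂ) (m : ZMod d × ZMod d) :
    Matrix (ZMod d) (ZMod d) ℂ :=
  let initial : Matrix ((ZMod d × A₀) × (R × ZMod d)) ((ZMod d × A₀) × (R × ZMod d)) ℂ :=
    dyad fun x => maxEnt (x.1.1, x.2.2) * Ψ (x.1.2, x.2.1)
  let final := ampliate Ξ (ampliate (Δ m) initial)
  let postMeasured : Matrix (ZMod d) (ZMod d) ℂ :=
    Matrix.of fun c c' => ∑ y : A₁ × R, ∑ y' : A₁ × R,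
      star (v y) * final (y.1, (y.2, c)) (y'.1, (y'.2, c')) * v y'
  weyl m.1 m.2 * postMeasured * (weyl m.1 m.2)ᴴ

end Alice

namespace QOTT

variable {d p : ℕ} [NeZero d] [Fact p.Prime] {A B S : Type*}
    [Fintype A] [DecidableEq A] [Fintype B] [DecidableEq B] [Fintype S] [DecidableEq S]
    (T : QOTT d p A B S)

/-- `SETUP`: the vector `(1_E ⊗ M ⊗ X^{j₁i₁} Z^{j₂i₂}) |Θ⟩_{EC} |Ω⟩_{SK}` on `EA` (Alice) and `BK`
(Bob), for Alice's indices `i` and Bob's indices `j`. -/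
def setup (i j : ZMod p × ZMod p) : (ZMod d × A) × (B × ZMod p) → ℂ := fun x =>
  ∑ c, ∑ s, ∑ κ, T.M (x.1.2, x.2.1) (c, s) * weyl (j.1 * i.1) (j.2 * i.2) x.2.2 κ *
    (maxEnt (x.1.1, c) * T.Ω (s, κ))

/-- The unnormalized state of Alice's system `A'` and Bob's systems `BK` after `COMMIT`, when Alice
applies the subchannels `Δ` to `EA` and announces the outcome `m = (a, b)`. -/
def committed {A' : Type*}
    (Δ : ZMod d × ZMod d → (Matrix (ZMod d × A) (ZMod d × A) ℂ →ₗ[ℂ] Matrix A' A' ℂ))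
    (i j : ZMod p × ZMod p) (m : ZMod d × ZMod d) :
    Matrix (A' × (B × ZMod p)) (A' × (B × ZMod p)) ℂ :=
  ampliate (Δ m) (dyad (T.setup i j))

/-- The unnormalized state of Bob's systems `BK` after `COMMIT`, when the announced outcome is `m`,
Bob holds the indices `j`, and Alice honestly commits to `ρ`; her indices `i`, unknown to Bob, are
uniform. -/
def bobView (ρ : Matrix (ZMod d) (ZMod d) ℂ) (j : ZMod p × ZMod p) (m : ZMod d × ZMod d) :
    Matrix (B × ZMod p) (B × ZMod p) ℂ :=
  ((p : ℂ) ^ 2)⁻¹ • ∑ i : ZMod p × ZMod p, ptrLeft (T.committed (honestCommit ρ) i j m)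

/-- Bob's operator `AB K → C` in `REVEAL` for reported indices `k`, when his check succeeds:
apply `Z^{-j₂k₂} X^{-j₁k₁}` to `K`, apply `M†` to `AB`, project `SK` onto `|Ω⟩`, and finally apply
`X^a Z^b` to `C`. -/
def revealOp (j k : ZMod p × ZMod p) (m : ZMod d × ZMod d) :
    Matrix (ZMod d) (A × (B × ZMod p)) ℂ :=
  weyl m.1 m.2 * Matrix.of fun c y => ∑ s, ∑ κ,
    star (T.Ω (s, κ)) * T.Mᴴ (c, s) (y.1, y.2.1) *
      (pauliZ p ^ (-(j.2 * k.2)).val * pauliX p ^ (-(j.1 * k.1)).val) κ y.2.2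

/-- The unnormalized state of `C` accepted by Bob, when the indices `i`, `j` were distributed, Alice
applied the subchannels `Δ` in `COMMIT` and announced `m`, and in `REVEAL` she reports `k` and sends
the system `A` produced by applying `Ξ` to `A'`. Its trace is the probability of these events
(given `i`, `j`) and of Bob's check succeeding. -/
def accepted {A' : Type*}
    (Δ : ZMod d × ZMod d → (Matrix (ZMod d × A) (ZMod d × A) ℂ →ₗ[ℂ] Matrix A' A' ℂ))
    (Ξ : Matrix A' A' ℂ →ₗ[ℂ] Matrix A A ℂ)
    (i j k : ZMod p × ZMod p) (m : ZMod d × ZMod d) : Matrix (ZMod d) (ZMod d) ℂ :=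
  T.revealOp j k m * ampliate Ξ (T.committed Δ i j m) * (T.revealOp j k m)ᴴ

/-- The probability, over Bob's uniform indices `j ∈ J × J` and the outcomes of `COMMIT`, that Alice,
having received `i`, reports `k` and passes Bob's check. Here `Ξ` is the operation that
accompanies the report `k`. -/
def passProb {A' : Type*}
    (Δ : ZMod d × ZMod d → (Matrix (ZMod d × A) (ZMod d × A) ℂ →ₗ[ℂ] Matrix A' A' ℂ))
    (Ξ : Matrix A' A' ℂ →ₗ[ℂ] Matrix A A ℂ) (i k : ZMod p × ZMod p) : ℝ :=
  ((T.J.card : ℝ) ^ 2)⁻¹ *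
    ∑ j ∈ T.J ×ˢ T.J, ∑ m : ZMod d × ZMod d, (T.accepted Δ Ξ i j k m).trace.re

end QOTT

end QC

end

/-! The safe state is flat of rank p, so the key system of `Ω` is maximally mixed. Hence the
isometry W = `dilation`, ψ ↦ (M ⊗ 1)(ψ ⊗ Ω), satisfies W†(1 ⊗ N)W = (tr N / p)·1 for every operator
N on K (`conjTranspose_dilation_mul_mul`). The encryption of K commutes with everything Alice does,
so the indices enter the accepted state only through one product, (X^{j₁i₁}Z^{j₂i₂})†
X^{j₁k₁}Z^{j₂k₂}, inserted into Bob's check (`accepted_eq`).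

True indices: the inserted product is 1. Masking says that W followed by discarding BK is a constant
channel, so uniqueness of dilations (`exists_isometry_factor`) gives W = (1 ⊗ U)(Ψ ⊗ ·) with U an
isometry into Bob's systems. In the check U meets its adjoint and cancels, leaving exactly delayed
teleportation with ancilla Ψ. After an honest commitment the secret sits in C beside an independent
Ψ, so tampering with A costs only the scalar q.

Concealment: for nonzero j the map i ↦ (j₁i₁, j₂i₂) is a bijection, so averaging over i is the full
Weyl twirl. It depolarizes K and leaves on B the marginal of the masker, which is constant
(`bobView_eq`).

Wrong indices: the checks for j and l have inner product proportional to the trace of a Weyl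
operator with exponents (j₁-l₁)(i₁-k₁) and (j₂-l₂)(i₂-k₂) up to sign. In a coordinate where i and k
differ, distinct values of j therefore give isometries with orthogonal ranges. Bessel's inequality
handles the sum over that coordinate, the other one contributes a factor |J|, and |J|/|J|² = 1/|J|
(`sum_passProb_le`).

Tables with large J come from the code c ↦ ∑ⱼ |j+c⟩|j+2c⟩|j⟩ modulo a large prime (`exists_qott`).
-/

namespace QC

/-! ### Linear maps acting on one factor of a joint system. -/

section Maps

variable {X Y R R' ι : Type*}

lemma ampliate_sum_left (s : Finset ι) (Φ : ι → Matrix X X ℂ →ₗ[ℂ] Matrix Y Y ℂ)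
    (σ : Matrix (X × R) (X × R) ℂ) :
    ampliate (∑ m ∈ s, Φ m) σ = ∑ m ∈ s, ampliate (Φ m) σ := by
  ext y y'; simp [ampliate, LinearMap.sum_apply, Matrix.sum_apply]

lemma ampliate_smul (Φ : Matrix X X ℂ →ₗ[ℂ] Matrix Y Y ℂ) (c : ℂ)
    (σ : Matrix (X × R) (X × R) ℂ) : ampliate Φ (c • σ) = c • ampliate Φ σ := by
  ext y y'
  have : (Matrix.of fun x x' => (c • σ) (x, y.2) (x', y'.2)) =
      c • (Matrix.of fun x x' => σ (x, y.2) (x', y'.2)) := by ext; simp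
  simp only [ampliate, Matrix.of_apply, this, map_smul]
  rfl

lemma one_kronecker_mul_mul_apply [Fintype X] [Fintype R] [DecidableEq X]
    (U : Matrix R' R ℂ) (U' : Matrix R R' ℂ) (σ : Matrix (X × R) (X × R) ℂ) (x x' : X) (r r' : R') :
    (((1 : Matrix X X ℂ) ⊗ₖ U) * σ * ((1 : Matrix X X ℂ) ⊗ₖ U')) (x, r) (x', r') =
      ∑ s, ∑ t, (U r s * U' t r') * σ (x, s) (x', t) := by
  simp only [Matrix.mul_apply, Matrix.kroneckerMap_apply, Fintype.sum_prod_type, Finset.sum_mul,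
    Matrix.one_apply, ite_mul, one_mul, zero_mul, mul_ite, mul_zero]
  simp only [Finset.sum_ite_irrel, Finset.sum_const_zero, Finset.sum_ite_eq, Finset.sum_ite_eq',
    Finset.mem_univ, if_true]
  rw [Finset.sum_comm]
  exact Finset.sum_congr rfl fun s _ => Finset.sum_congr rfl fun t _ => by ring

/-- A map on the left factor commutes with operators on the right factor. -/
lemma ampliate_one_kronecker_mul_mul [Fintype X] [Fintype Y] [Fintype R] [DecidableEq X]
    [DecidableEq Y]
    (Φ : Matrix X X ℂ →ₗ[ℂ] Matrix Y Y ℂ) (U : Matrix R' R ℂ) (U' : Matrix R R' ℂ)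
    (σ : Matrix (X × R) (X × R) ℂ) :
    ampliate Φ (((1 : Matrix X X ℂ) ⊗ₖ U) * σ * ((1 : Matrix X X ℂ) ⊗ₖ U')) =
      ((1 : Matrix Y Y ℂ) ⊗ₖ U) * ampliate Φ σ * ((1 : Matrix Y Y ℂ) ⊗ₖ U') := by
  ext ⟨y, r⟩ ⟨y', r'⟩
  rw [one_kronecker_mul_mul_apply]
  have : (Matrix.of fun x x' => (((1 : Matrix X X ℂ) ⊗ₖ U) * σ * ((1 : Matrix X X ℂ) ⊗ₖ U'))
      (x, r) (x', r')) =
      ∑ s, ∑ t, (U r s * U' t r') • (Matrix.of fun x x' => σ (x, s) (x', t)) := by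
    ext x x'
    simp [one_kronecker_mul_mul_apply, Matrix.sum_apply]
  simp only [ampliate, Matrix.of_apply, this, map_sum, map_smul, Matrix.sum_apply,
    Matrix.smul_apply, smul_eq_mul]

/-- Complete positivity is defined with ancillas `Fin n` only; relabelling the basis of the ancilla
extends it to any finite index type. -/
lemma IsCP.posSemidef_ampliate [Fintype R] {Φ : Matrix X X ℂ →ₗ[ℂ] Matrix Y Y ℂ} (h : IsCP Φ)
    {σ : Matrix (X × R) (X × R) ℂ} (hσ : σ.PosSemidef) : (ampliate Φ σ).PosSemidef := by
  let e := Fintype.equivFin R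
  have := (h _ _ (hσ.submatrix (Prod.map id e.symm))).submatrix (Prod.map (id : Y → Y) e)
  convert this using 1
  ext y y'
  simp [ampliate]

lemma trace_ampliate_eq_sum [Fintype Y] [Fintype R] (Φ : Matrix X X ℂ →ₗ[ℂ] Matrix Y Y ℂ)
    (σ : Matrix (X × R) (X × R) ℂ) :
    (ampliate Φ σ).trace = ∑ r, (Φ (Matrix.of fun x x' => σ (x, r) (x', r))).trace := by
  simp only [Matrix.trace, Matrix.diag_apply, ampliate, Matrix.of_apply, Fintype.sum_prod_type]
  exact Finset.sum_comm

lemma IsChannel.trace_ampliate [Fintype X] [Fintype Y] [Fintype R]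
    {Φ : Matrix X X ℂ →ₗ[ℂ] Matrix Y Y ℂ} (h : IsChannel Φ)
    (σ : Matrix (X × R) (X × R) ℂ) : (ampliate Φ σ).trace = σ.trace := by
  rw [trace_ampliate_eq_sum]
  simp only [h.2]
  simp only [Matrix.trace, Matrix.diag_apply, Matrix.of_apply, Fintype.sum_prod_type]
  exact Finset.sum_comm

lemma IsInstrument.sum_trace_ampliate [Fintype X] [Fintype Y] [Fintype R] [Fintype ι]
    {Φ : ι → Matrix X X ℂ →ₗ[ℂ] Matrix Y Y ℂ}
    (h : IsInstrument Φ) (σ : Matrix (X × R) (X × R) ℂ) :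
    ∑ m, (ampliate (Φ m) σ).trace = σ.trace := by
  rw [← h.2.trace_ampliate σ, ampliate_sum_left, Matrix.trace_sum]

end Maps

/-! ### Rank-one operators and extension from density operators. -/

section Dyads

variable {X Y : Type*}

lemma dyad_apply (v : X → ℂ) (x x' : X) : dyad v x x' = v x * star (v x') := rfl

lemma posSemidef_dyad [Fintype X] (v : X → ℂ) : (dyad v).PosSemidef :=
  Matrix.posSemidef_vecMulVec_self_star v

lemma trace_dyad [Fintype X] (v : X → ℂ) : (dyad v).trace = ∑ x, v x * star (v x) := rfl

lemma dyad_mulVec [Fintype X] (U : Matrix Y X ℂ) (v : X → ℂ) : dyad (U *ᵥ v) = U * dyad v * Uᴴ := by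
  rw [dyad, dyad, Matrix.star_mulVec, Matrix.mul_vecMulVec, Matrix.vecMulVec_mul]

/-- Linear maps that agree on density operators agree. -/
lemma linearMap_ext_of_density [Fintype X] {N : Type*} [AddCommGroup N] [Module ℂ N] [DecidableEq X]
    {L L' : Matrix X X ℂ →ₗ[ℂ] N} (h : ∀ ρ, IsDensity ρ → L ρ = L' ρ) : L = L' := by
  have hd (v : X → ℂ) : L (dyad v) = L' (dyad v) := by
    -- A dyad is either zero or a scalar multiple of a density operator.
    by_cases ht : (dyad v).trace = 0
    · have : dyad v = 0 := (posSemidef_dyad v).trace_eq_zero_iff.1 ht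
      simp [this]
    · have h0 := (posSemidef_dyad v).trace_nonneg
      have := h ((dyad v).trace⁻¹ • dyad v)
        ⟨(posSemidef_dyad v).smul (by simpa using h0), by simp [ht]⟩
      simp only [map_smul] at this
      exact smul_right_injective N (inv_ne_zero ht) this
  have hs (c : X) : L (Matrix.single c c 1) = L' (Matrix.single c c 1) := by
    convert hd (Pi.single c 1) using 2 <;>
    · ext x y; simp [dyad_apply, Matrix.single_apply, Pi.single_apply]; grind
  -- Polarization: z = 1 gives the sum of the two off-diagonal units, and z = I, after
  -- multiplication by I, gives their difference. Adding isolates one unit with factor 2.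
  have hp (c c' : X) (z : ℂ) : dyad (Pi.single c 1 + z • Pi.single c' 1) =
      Matrix.single c c 1 + star z • Matrix.single c c' 1 + z • Matrix.single c' c 1 +
        (z * star z) • Matrix.single c' c' 1 := by
    ext x y
    simp only [dyad_apply, Matrix.single_apply, Pi.single_apply, Pi.add_apply, Pi.smul_apply,
      Matrix.add_apply, Matrix.smul_apply, smul_eq_mul, star_add, star_mul, apply_ite star,
      star_one, star_zero]
    by_cases h1 : x = c <;> by_cases h2 : x = c' <;> by_cases h3 : y = c <;>
      by_cases h4 : y = c' <;> simp [h1, h2, h3, h4, eq_comm] <;> grind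
  have key (c c' : X) : L (Matrix.single c c' 1) = L' (Matrix.single c c' 1) := by
    have h1 := hd (Pi.single c 1 + (1 : ℂ) • Pi.single c' 1)
    have h2 := hd (Pi.single c 1 + Complex.I • Pi.single c' 1)
    rw [hp] at h1 h2
    simp only [map_add, map_smul, hs, star_one, one_smul, mul_one, add_left_inj] at h1 h2
    rw [add_assoc, add_assoc, add_right_inj] at h1 h2
    simp only [Complex.star_def, Complex.conj_I, neg_smul] at h2
    have h3 := congrArg (Complex.I • ·) h2
    simp only [smul_add, smul_neg, smul_smul, Complex.I_mul_I, neg_smul, one_smul, neg_neg] at h3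
    have h4 : (2 : ℂ) • L (Matrix.single c c' 1) = (2 : ℂ) • L' (Matrix.single c c' 1) := by
      rw [two_smul, two_smul]
      have h5 := congrArg₂ (· + ·) h1 h3
      simp only [← sub_eq_add_neg, add_add_sub_cancel] at h5
      exact h5
    exact smul_right_injective N two_ne_zero h4
  refine LinearMap.ext fun ρ => ?_
  rw [Matrix.matrix_eq_sum_single ρ]
  simp only [map_sum]
  refine Finset.sum_congr rfl fun x _ => Finset.sum_congr rfl fun y _ => ?_
  have : Matrix.single x y (ρ x y) = ρ x y • Matrix.single x y (1 : ℂ) := by simp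
  rw [this, map_smul, map_smul, key]

end Dyads

/-! ### Orthogonal isometries and uniqueness of dilations. -/

section Isometries

variable {X C ι : Type*} [DecidableEq C]

/-- Bessel's inequality for isometries with mutually orthogonal ranges. -/
lemma sum_trace_conjTranspose_mul_mul_le [Fintype X] [Fintype C] [DecidableEq X]
    [DecidableEq ι] (s : Finset ι)
    (Q : ι → Matrix X C ℂ)
    (hQ : ∀ i ∈ s, ∀ j ∈ s, (Q i)ᴴ * Q j = if i = j then 1 else 0)
    {τ : Matrix X X ℂ} (hτ : τ.PosSemidef) :
    ∑ i ∈ s, ((Q i)ᴴ * τ * Q i).trace.re ≤ τ.trace.re := by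
  -- P is the orthogonal projection onto the sum of the ranges; the inequality is nonnegativity of
  -- the trace of (1-P)τ(1-P).
  set P := ∑ i ∈ s, Q i * (Q i)ᴴ with hP
  have hPH : Pᴴ = P := by simp [hP, Matrix.conjTranspose_sum]
  have hPP : P * P = P := by
    simp only [hP, Matrix.sum_mul, Matrix.mul_sum]
    refine Finset.sum_congr rfl fun i hi => ?_
    rw [Finset.sum_eq_single i]
    · rw [Matrix.mul_assoc, ← Matrix.mul_assoc (Q i)ᴴ, hQ i hi i hi]; simp
    · intro j hj hji
      rw [Matrix.mul_assoc, ← Matrix.mul_assoc (Q j)ᴴ, hQ j hj i hi]; simp [hji]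
    · exact fun h => absurd hi h
  have h0 := (hτ.mul_mul_conjTranspose_same (1 - P)).trace_nonneg
  have h1 : ((1 - P) * τ * (1 - P)ᴴ).trace = τ.trace - (P * τ).trace := by
    rw [Matrix.trace_mul_comm, ← Matrix.mul_assoc, Matrix.conjTranspose_sub, hPH]
    simp [Matrix.sub_mul, Matrix.mul_sub, hPP]
  have h2 : (P * τ).trace = ∑ i ∈ s, ((Q i)ᴴ * τ * Q i).trace := by
    rw [hP, Matrix.sum_mul, Matrix.trace_sum]
    refine Finset.sum_congr rfl fun i _ => ?_
    rw [Matrix.mul_assoc, Matrix.trace_mul_comm]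
  rw [h1, h2] at h0
  have := (Complex.le_def.1 h0).1
  simp at this
  linarith

/-- Uniqueness of minimal dilations, for a constant channel `C → A` with output `α`: any
dilation `V` factors through the product dilation given by a purification `Ψ` of `α`. -/
lemma exists_isometry_factor {A R : Type*} [Fintype A] [DecidableEq A] [Fintype R]
    (V : C → Matrix A R ℂ) {α : Matrix A A ℂ} (hα : α.PosSemidef)
    (hV : ∀ c c', V c * (V c')ᴴ = if c = c' then α else 0) :
    ∃ (r : ℕ) (Ψ : A × Fin r → ℂ) (U : Matrix R (Fin r × C) ℂ), Uᴴ * U = 1 ∧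
      ∀ a y c, V c a y = ∑ t, Ψ (a, t) * U y (t, c) := by
  classical
  let l := hα.isHermitian.eigenvalues
  let u : Matrix A A ℂ := hα.isHermitian.eigenvectorUnitary
  have huu : u * uᴴ = 1 := (Matrix.mem_unitaryGroup_iff).1 hα.isHermitian.eigenvectorUnitary.2
  have hdiag : uᴴ * α * u = Matrix.diagonal fun s => (l s : ℂ) := by
    have := hα.isHermitian.conjStarAlgAut_star_eigenvectorUnitary
    rw [Unitary.conjStarAlgAut_apply] at this
    simpa [u, l, Matrix.star_eq_conjTranspose, Function.comp_def] using this
  -- In the eigenbasis of α, the rows of all the `G c` together form an orthogonal family, with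
  -- squared norms the eigenvalues `l s`.
  let G : C → Matrix A R ℂ := fun c => uᴴ * V c
  have hG (c c') : G c * (G c')ᴴ =
      if c = c' then Matrix.diagonal fun s => (l s : ℂ) else 0 := by
    simp only [G, Matrix.conjTranspose_mul, Matrix.conjTranspose_conjTranspose]
    rw [Matrix.mul_assoc, ← Matrix.mul_assoc (V c), hV]
    split_ifs
    · rw [← Matrix.mul_assoc, hdiag]
    · simp
  have hGs (c c' s s') : ∑ y, G c s y * star (G c' s' y) =
      if c = c' ∧ s = s' then (l s : ℂ) else 0 := by
    have := congrFun (congrFun (hG c c') s) s'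
    rw [Matrix.mul_apply] at this
    simp only [Matrix.conjTranspose_apply] at this
    rw [this]
    by_cases h : c = c' <;> simp [h, Matrix.diagonal_apply]
  have hl (s) : 0 ≤ l s := hα.eigenvalues_nonneg s
  have hG0 (c s y) (h : l s = 0) : G c s y = 0 := by
    have := hGs c c s s
    simp only [and_self, if_true, h, Complex.ofReal_zero] at this
    have h2 := (Finset.sum_eq_zero_iff_of_nonneg
      (fun y _ => mul_star_self_nonneg (G c s y))).1 this y (Finset.mem_univ _)
    simpa using h2
  -- Rows with eigenvalue zero vanish and cannot be normalized, so the ancilla has one basis vector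
  -- per nonzero eigenvalue.
  let e := (Fintype.equivFin {s // l s ≠ 0}).symm
  have hsq (t) : ((Real.sqrt (l (e t)) : ℝ) : ℂ) * (Real.sqrt (l (e t)) : ℝ) = l (e t) := by
    rw [← Complex.ofReal_mul, Real.mul_self_sqrt (hl _)]
  have hsq0 (t) : ((Real.sqrt (l (e t)) : ℝ) : ℂ) ≠ 0 := fun h => by
    have := hsq t
    rw [h, mul_zero] at this
    exact (e t).2 (by exact_mod_cast this.symm)
  -- Ψ is the canonical purification ∑ √l_t u_t ⊗ t, and the columns of U are the rows of the `G c`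
  -- divided by √l_t, hence orthonormal.
  refine ⟨_, fun x => u x.1 (e x.2) * (Real.sqrt (l (e x.2)) : ℝ),
    Matrix.of fun y x => ((Real.sqrt (l (e x.1)) : ℝ) : ℂ)⁻¹ * G x.2 (e x.1) y, ?_, ?_⟩
  · ext ⟨t, c⟩ ⟨t', c'⟩
    rw [Matrix.mul_apply]
    simp only [Matrix.conjTranspose_apply, Matrix.of_apply, star_mul, star_inv₀,
      Complex.star_def, Complex.conj_ofReal]
    have : ∀ y, (starRingEnd ℂ) (G c (e t) y) * ((Real.sqrt (l (e t)) : ℝ) : ℂ)⁻¹ *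
        (((Real.sqrt (l (e t')) : ℝ) : ℂ)⁻¹ * G c' (e t') y) =
        (((Real.sqrt (l (e t)) : ℝ) : ℂ)⁻¹ * ((Real.sqrt (l (e t')) : ℝ) : ℂ)⁻¹) *
          (G c' (e t') y * star (G c (e t) y)) := fun y => by
      simp only [Complex.star_def]; ring
    simp only [this, ← Finset.mul_sum, hGs, Matrix.one_apply, Prod.mk.injEq]
    by_cases hc : c = c'
    · by_cases ht : t = t'
      · subst hc ht
        simp only [and_self, if_true, ← hsq]
        field_simp [hsq0 t]
      · have : (e t' : A) ≠ e t := fun h => ht (e.injective (Subtype.ext h)).symm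
        simp [ht, this]
    · simp [hc, eq_comm]
  · intro a y c
    have h1 : V c = u * G c := by simp [G, ← Matrix.mul_assoc, huu]
    have h2 (t) : (u a (e t) * (Real.sqrt (l (e t)) : ℝ)) *
        (((Real.sqrt (l (e t)) : ℝ) : ℂ)⁻¹ * G c (e t) y) = u a (e t) * G c (e t) y := by
      have := hsq0 t
      field_simp
    simp only [Matrix.of_apply, h2]
    rw [e.sum_comp (fun s : {s // l s ≠ 0} => u a s * G c s y), h1, Matrix.mul_apply]
    rw [← Fintype.sum_subtype_add_sum_subtype (fun s => l s ≠ 0), add_eq_left]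
    exact Finset.sum_eq_zero fun s _ => by rw [hG0 c s y (not_not.1 s.2), mul_zero]

end Isometries

/-! ### Weyl operators: products, traces and twirl. -/

section Weyl

variable {n : ℕ} [NeZero n]

lemma pauliX_pow_apply (k : ℕ) (r c : ZMod n) :
    (pauliX n ^ k) r c = if r = c + k then 1 else 0 := by
  induction k generalizing r with
  | zero => simp [Matrix.one_apply]
  | succ k ih =>
    rw [pow_succ', Matrix.mul_apply]
    have h (j : ZMod n) : pauliX n r j = if j = r - 1 then 1 else 0 := by
      simp only [pauliX, Matrix.of_apply, eq_sub_iff_add_eq, eq_comm]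
    simp [h, ih, eq_sub_iff_add_eq, add_assoc, eq_comm (a := r)]

lemma pauliZ_pow (k : ℕ) :
    pauliZ n ^ k = Matrix.diagonal fun j => ZMod.stdAddChar ((k : ZMod n) * j) := by
  rw [pauliZ, Matrix.diagonal_pow]
  congr 1
  ext j
  simp [← AddChar.map_nsmul_eq_pow]

lemma weyl_apply (a b r c : ZMod n) :
    weyl a b r c = if r = c + a then ZMod.stdAddChar (b * c) else 0 := by
  simp [weyl, pauliZ_pow, pauliX_pow_apply]

lemma star_stdAddChar (x : ZMod n) :
    star (ZMod.stdAddChar x : ℂ) = ZMod.stdAddChar (-x) := by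
  simp [AddChar.map_neg_eq_conj]

/-- Moving Z^b past X^{a'} costs only a phase, so exponents add. Phases are irrelevant later, where
only the vanishing of traces matters. -/
lemma weyl_mul_weyl (a b a' b' : ZMod n) :
    weyl a b * weyl a' b' = (ZMod.stdAddChar (b * a') : ℂ) • weyl (a + a') (b + b') := by
  ext r c
  rw [Matrix.mul_apply]
  simp only [weyl_apply, Matrix.smul_apply, smul_eq_mul, mul_ite, mul_zero, Finset.sum_ite_eq',
    Finset.mem_univ, if_true, ite_mul, zero_mul, add_assoc, add_comm a' a,
    ← AddChar.map_add_eq_mul]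
  congr 2
  ring

lemma weyl_zero_zero : weyl (0 : ZMod n) 0 = 1 := by simp [weyl]

lemma conjTranspose_weyl (a b : ZMod n) :
    (weyl a b)ᴴ = (ZMod.stdAddChar (a * b) : ℂ) • weyl (-a) (-b) := by
  ext r c
  simp only [Matrix.conjTranspose_apply, weyl_apply, Matrix.smul_apply, smul_eq_mul,
    apply_ite star, star_stdAddChar, star_zero, mul_ite, mul_zero]
  by_cases h : c = r + a
  · have : r = c + -a := by rw [h]; ring
    rw [if_pos h, if_pos this, ← AddChar.map_add_eq_mul]
    congr 1
    rw [h]; ring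
  · have : ¬ r = c + -a := fun h' => h (by rw [h']; ring)
    rw [if_neg h, if_neg this]

lemma conjTranspose_weyl_mul_self (a b : ZMod n) : (weyl a b)ᴴ * weyl a b = 1 := by
  rw [conjTranspose_weyl, Matrix.smul_mul, weyl_mul_weyl, smul_smul, neg_add_cancel,
    neg_add_cancel, weyl_zero_zero, ← AddChar.map_add_eq_mul]
  simp [mul_comm]

lemma weyl_mul_conjTranspose_self (a b : ZMod n) : weyl a b * (weyl a b)ᴴ = 1 :=
  mul_eq_one_comm.1 (conjTranspose_weyl_mul_self a b)

/-- This identifies Bob's decryption with the adjoint of an encryption; in the order Z before X no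
phase appears. -/
lemma pauliZ_pow_mul_pauliX_pow (a b : ZMod n) :
    pauliZ n ^ (-b).val * pauliX n ^ (-a).val = (weyl a b)ᴴ := by
  ext r c
  simp only [pauliZ_pow, Matrix.diagonal_mul, pauliX_pow_apply, ZMod.natCast_val, ZMod.cast_id',
    id_eq, Matrix.conjTranspose_apply, weyl_apply, apply_ite star, star_stdAddChar, star_zero,
    mul_ite, mul_one, mul_zero, neg_mul]
  congr 1
  rw [eq_iff_iff]
  constructor <;> (intro h; rw [h]; ring)

lemma sum_stdAddChar_mul (x : ZMod n) :
    ∑ b : ZMod n, (ZMod.stdAddChar (b * x) : ℂ) = if x = 0 then (n : ℂ) else 0 := by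
  rw [AddChar.sum_mulShift x (ZMod.isPrimitive_stdAddChar n)]
  simp [ZMod.card]

/-- A nontrivial shift has empty diagonal; without a shift the trace is the sum of a nontrivial
character. -/
lemma trace_weyl_eq_zero {a b : ZMod n} (h : a ≠ 0 ∨ b ≠ 0) : (weyl a b).trace = 0 := by
  simp only [Matrix.trace, Matrix.diag_apply, weyl_apply, left_eq_add]
  by_cases ha : a = 0
  · have hb : b ≠ 0 := h.resolve_left (not_not.2 ha)
    simp [ha, mul_comm b, sum_stdAddChar_mul, hb]
  · simp [ha]

/-- The products of keys that occur when Alice reports a wrong index have trace zero. -/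
lemma trace_weyl_four_eq_zero {a b a₁ b₁ a₂ b₂ a₃ b₃ : ZMod n}
    (h : -a + a₁ - a₂ + a₃ ≠ 0 ∨ -b + b₁ - b₂ + b₃ ≠ 0) :
    ((weyl a b)ᴴ * weyl a₁ b₁ * ((weyl a₂ b₂)ᴴ * weyl a₃ b₃)).trace = 0 := by
  simp only [conjTranspose_weyl, Matrix.smul_mul, Matrix.mul_smul, weyl_mul_weyl,
    Matrix.trace_smul]
  rw [trace_weyl_eq_zero]
  · simp
  · simpa [sub_eq_add_neg, add_assoc] using h

/-- Averaging over the Weyl operators is the completely depolarizing map. -/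
lemma sum_weyl_mul_star_weyl (r c r' c' : ZMod n) :
    ∑ g : ZMod n × ZMod n, weyl g.1 g.2 r c * star (weyl g.1 g.2 r' c') =
      if r = r' ∧ c = c' then (n : ℂ) else 0 := by
  have h (a b : ZMod n) : weyl a b r c * star (weyl a b r' c') =
      if a = r - c ∧ a = r' - c' then (ZMod.stdAddChar (b * (c - c')) : ℂ) else 0 := by
    rw [weyl_apply, weyl_apply]
    have e1 : r = c + a ↔ a = r - c := by grind
    have e2 : r' = c' + a ↔ a = r' - c' := by grind
    simp only [e1, e2, apply_ite star, star_zero, star_stdAddChar, ite_mul, zero_mul, mul_ite,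
      mul_zero, ← AddChar.map_add_eq_mul]
    rw [mul_sub, sub_eq_add_neg (b * c)]
    split_ifs <;> first | rfl | tauto
  -- The sum over b is a character sum that forces c = c'; the single surviving shift a then forces
  -- r = r'.
  simp only [Fintype.sum_prod_type, h, Finset.sum_ite_irrel, Finset.sum_const_zero,
    sum_stdAddChar_mul, sub_eq_zero]
  by_cases hc : c = c'
  · subst hc
    simp [ite_and]
  · simp [hc]

lemma bell_apply (a b x e : ZMod n) :
    bell a b (x, e) = weyl a b x e * ((Real.sqrt n : ℝ) : ℂ)⁻¹ := by
  simp [bell, Matrix.mulVec, dotProduct, Fintype.sum_prod_type, maxEnt, Matrix.one_apply,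
    Matrix.kroneckerMap_apply]

end Weyl

/-! ### The dilation of the masker and its factorization. -/

namespace QOTT

variable {d p : ℕ} [NeZero d] [Fact p.Prime] {A B S : Type*}
    [Fintype A] [DecidableEq A] [Fintype B] [DecidableEq B] [Fintype S] [DecidableEq S]
    (T : QOTT d p A B S)

/-- The reduced state of the key is maximally mixed. -/
lemma sum_star_Ω_mul_Ω (κ κ' : ZMod p) :
    ∑ s, star (T.Ω (s, κ)) * T.Ω (s, κ') = if κ = κ' then (p : ℂ)⁻¹ else 0 := by
  let N : Matrix S (ZMod p) ℂ := Matrix.of fun s κ => T.Ω (s, κ)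
  have hN : N * Nᴴ = T.safe := by
    rw [← T.purifies]; ext s s'; simp [N, Matrix.mul_apply, ptrRight, dyad_apply]
  have hp : (p : ℂ)⁻¹ ≠ 0 := inv_ne_zero (Nat.cast_ne_zero.2 (Fact.out : p.Prime).ne_zero)
  -- On E the operator NN† is the scalar 1/p, so N† is injective there. Since dim E = p = dim K, it
  -- maps E onto the key space, and N†N = 1/p can be checked on vectors N†v.
  let E := Module.End.eigenspace (Matrix.toLin' T.safe) (p : ℂ)⁻¹
  have hE (v : E) : N *ᵥ (Nᴴ *ᵥ v.1) = (p : ℂ)⁻¹ • v.1 := by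
    rw [Matrix.mulVec_mulVec, hN]
    simpa using Module.End.mem_eigenspace_iff.1 v.2
  let f : E →ₗ[ℂ] (ZMod p → ℂ) := (Matrix.toLin' Nᴴ).comp E.subtype
  have hf (v : E) : f v = Nᴴ *ᵥ v.1 := by simp [f]
  have hinj : Function.Injective f := by
    rw [← LinearMap.ker_eq_bot, LinearMap.ker_eq_bot']
    intro v hv
    rw [hf] at hv
    have := hE v
    rw [hv, Matrix.mulVec_zero] at this
    exact Subtype.ext ((smul_eq_zero.1 this.symm).resolve_left hp)
  have hsurj : Function.Surjective f :=
    (LinearMap.injective_iff_surjective_of_finrank_eq_finrank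
      (by rw [T.safe_degeneracy]; simp [ZMod.card])).1 hinj
  have h1 : Nᴴ * N = (p : ℂ)⁻¹ • 1 := by
    refine Matrix.ext_of_mulVec_single fun κ => ?_
    obtain ⟨v, hv⟩ := hsurj (Pi.single κ 1)
    rw [← hv, hf, ← Matrix.mulVec_mulVec, hE, Matrix.mulVec_smul, Matrix.smul_mulVec,
      Matrix.one_mulVec]
  have h2 := congrFun (congrFun h1 κ) κ'
  simpa [N, Matrix.mul_apply, Matrix.one_apply] using h2

/-- The operator `C → CS` that adjoins the safe system in the (unnormalized) state `⟨κ|Ω⟩`. -/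
noncomputable def adjoinSafe (κ : ZMod p) : Matrix (ZMod d × S) (ZMod d) ℂ :=
  Matrix.of fun x c => if x.1 = c then T.Ω (x.2, κ) else 0

/-- The isometry `C → ABK`, `ψ ↦ (M ⊗ 1)(ψ ⊗ Ω)`, that dilates the masker. -/
noncomputable def dilation : Matrix (A × (B × ZMod p)) (ZMod d) ℂ :=
  Matrix.of fun y c => (T.M * T.adjoinSafe y.2.2) (y.1, y.2.1) c

lemma dilation_apply (a : A) (b : B) (κ : ZMod p) (c : ZMod d) :
    T.dilation (a, (b, κ)) c = ∑ s, T.M (a, b) (c, s) * T.Ω (s, κ) := by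
  simp only [dilation, Matrix.of_apply, Matrix.mul_apply, adjoinSafe, Fintype.sum_prod_type,
    mul_ite, mul_zero, Finset.sum_ite_irrel, Finset.sum_const_zero, Finset.sum_ite_eq',
    Finset.mem_univ, if_true]

lemma conjTranspose_adjoinSafe_mul (κ κ' : ZMod p) :
    (T.adjoinSafe κ)ᴴ * T.adjoinSafe κ' = if κ = κ' then (p : ℂ)⁻¹ • 1 else 0 := by
  ext c c'
  have : ((T.adjoinSafe κ)ᴴ * T.adjoinSafe κ') c c' =
      if c = c' then ∑ s, star (T.Ω (s, κ)) * T.Ω (s, κ') else 0 := by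
    simp only [Matrix.mul_apply, Matrix.conjTranspose_apply, adjoinSafe, Matrix.of_apply,
      Fintype.sum_prod_type, apply_ite star, star_zero, ite_mul, zero_mul, mul_ite, mul_zero]
    simp only [Finset.sum_ite_irrel, Finset.sum_const_zero, Finset.sum_ite_eq',
      Finset.mem_univ, if_true]
    split_ifs <;> simp_all
  rw [this, sum_star_Ω_mul_Ω]
  by_cases h : c = c' <;> by_cases h' : κ = κ' <;> simp [h, h']

lemma sum_adjoinSafe_mul_mul (ρ : Matrix (ZMod d) (ZMod d) ℂ) :
    ∑ κ, T.adjoinSafe κ * ρ * (T.adjoinSafe κ)ᴴ = ρ ⊗ₖ T.safe := by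
  ext ⟨c, s⟩ ⟨c', s'⟩
  rw [← T.purifies]
  simp [Matrix.sum_apply, Matrix.mul_apply, adjoinSafe, ptrRight, dyad_apply, Finset.mul_sum,
    apply_ite (starRingEnd ℂ)]
  exact Finset.sum_congr rfl fun κ _ => by ring

/-- Tracing out the key of the dilation gives the masker. -/
lemma sum_dilation_mul_mul (ρ : Matrix (ZMod d) (ZMod d) ℂ) (a a' : A) (b b' : B) :
    ∑ κ, (T.dilation * ρ * T.dilationᴴ) (a, (b, κ)) (a', (b', κ)) =
      (T.M * (ρ ⊗ₖ T.safe) * T.Mᴴ) (a, b) (a', b') := by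
  rw [← sum_adjoinSafe_mul_mul, Matrix.mul_sum, Matrix.sum_mul, Matrix.sum_apply]
  refine Finset.sum_congr rfl fun κ _ => ?_
  have : T.M * (T.adjoinSafe κ * ρ * (T.adjoinSafe κ)ᴴ) * T.Mᴴ =
      (T.M * T.adjoinSafe κ) * ρ * (T.M * T.adjoinSafe κ)ᴴ := by
    simp only [Matrix.conjTranspose_mul, Matrix.mul_assoc]
  rw [this]
  rfl

/-- The action of an operator on the key. -/
lemma one_kronecker_mul_dilation_apply (N : Matrix (ZMod p) (ZMod p) ℂ) (a : A) (b : B)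
    (κ : ZMod p) (c : ZMod d) :
    (((1 : Matrix A A ℂ) ⊗ₖ ((1 : Matrix B B ℂ) ⊗ₖ N)) * T.dilation) (a, (b, κ)) c =
      ∑ κ', N κ κ' * T.dilation (a, (b, κ')) c := by
  simp [Matrix.mul_apply, Fintype.sum_prod_type, Matrix.one_apply, Finset.sum_ite_irrel]

/-- M cancels because it is an isometry, and what remains is the expectation of N in the key state,
which is maximally mixed whatever the input on C. Normalization and orthogonality of Bob's checks
both follow from this. -/
lemma conjTranspose_dilation_mul_mul (N : Matrix (ZMod p) (ZMod p) ℂ) :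
    T.dilationᴴ * (((1 : Matrix A A ℂ) ⊗ₖ ((1 : Matrix B B ℂ) ⊗ₖ N)) * T.dilation) =
      (N.trace * (p : ℂ)⁻¹) • 1 := by
  have h : T.dilationᴴ * (((1 : Matrix A A ℂ) ⊗ₖ ((1 : Matrix B B ℂ) ⊗ₖ N)) * T.dilation) =
      ∑ κ, ∑ κ', N κ κ' • ((T.M * T.adjoinSafe κ)ᴴ * (T.M * T.adjoinSafe κ')) := by
    ext c c'
    rw [Matrix.mul_apply]
    simp only [Fintype.sum_prod_type, one_kronecker_mul_dilation_apply, Finset.mul_sum]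
    rw [← Fintype.sum_prod_type' (f := fun a b => ∑ κ, ∑ κ', T.dilationᴴ c (a, (b, κ)) *
      (N κ κ' * T.dilation (a, (b, κ')) c')), Finset.sum_comm, Matrix.sum_apply]
    refine Finset.sum_congr rfl fun κ _ => ?_
    rw [Finset.sum_comm, Matrix.sum_apply]
    refine Finset.sum_congr rfl fun κ' _ => ?_
    rw [Matrix.smul_apply, Matrix.mul_apply, smul_eq_mul, Finset.mul_sum]
    exact Finset.sum_congr rfl fun x _ => mul_left_comm _ _ _
  rw [h]
  have h2 (κ κ') : (T.M * T.adjoinSafe κ)ᴴ * (T.M * T.adjoinSafe κ') =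
      if κ = κ' then (p : ℂ)⁻¹ • 1 else 0 := by
    rw [Matrix.conjTranspose_mul, Matrix.mul_assoc, ← Matrix.mul_assoc T.Mᴴ, T.isometry,
      Matrix.one_mul, conjTranspose_adjoinSafe_mul]
  simp only [h2, smul_ite, smul_zero, Finset.sum_ite_eq, Finset.mem_univ, if_true, Matrix.trace,
    Matrix.diag_apply, Finset.sum_mul, Finset.sum_smul, smul_smul]

lemma conjTranspose_dilation_mul_self : T.dilationᴴ * T.dilation = 1 := by
  have h := T.conjTranspose_dilation_mul_mul 1
  have hp : (p : ℂ) ≠ 0 := Nat.cast_ne_zero.2 (Fact.out : p.Prime).ne_zero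
  simpa [ZMod.card, hp] using h

/-- Masking speaks only of states; linearity extends it to all operators, so that it applies to the
off-diagonal units |c⟩⟨c'|. -/
lemma exists_ptrRight_mask : ∃ α : Matrix A A ℂ, ∀ ρ : Matrix (ZMod d) (ZMod d) ℂ,
    ptrRight (T.M * (ρ ⊗ₖ T.safe) * T.Mᴴ) = ρ.trace • α := by
  obtain ⟨α, hα⟩ := T.masks.1
  let L : Matrix (ZMod d) (ZMod d) ℂ →ₗ[ℂ] Matrix A A ℂ :=
    { toFun := fun ρ => ptrRight (T.M * (ρ ⊗ₖ T.safe) * T.Mᴴ)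
      map_add' := fun ρ ρ' => by
        ext; simp [ptrRight, Matrix.add_kronecker, Matrix.mul_add, Matrix.add_mul,
          Finset.sum_add_distrib]
      map_smul' := fun c ρ => by
        ext; simp [ptrRight, Matrix.smul_kronecker, Finset.mul_sum] }
  have : L = (Matrix.traceLinearMap (ZMod d) ℂ ℂ).smulRight α :=
    linearMap_ext_of_density fun ρ hρ => by simpa [L, hρ.2] using hα ρ hρ
  exact ⟨α, fun ρ => by simpa [L] using LinearMap.congr_fun this ρ⟩

lemma exists_dilation_factor : ∃ (r : ℕ) (Ψ : A × Fin r → ℂ)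
    (U : Matrix (B × ZMod p) (Fin r × ZMod d) ℂ), Uᴴ * U = 1 ∧
      ∀ a y c, T.dilation (a, y) c = ∑ t, Ψ (a, t) * U y (t, c) := by
  obtain ⟨α, hα⟩ := T.exists_ptrRight_mask
  let V : ZMod d → Matrix A (B × ZMod p) ℂ := fun c => Matrix.of fun a y => T.dilation (a, y) c
  have hV (c c') : V c * (V c')ᴴ = if c = c' then α else 0 := by
    -- The product is the A-marginal of W|c⟩⟨c'|W†, hence tr(|c⟩⟨c'|)·α.
    ext a a'
    have h1 : (V c * (V c')ᴴ) a a' =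
        ptrRight (T.M * (Matrix.single c c' 1 ⊗ₖ T.safe) * T.Mᴴ) a a' := by
      simp only [ptrRight, Matrix.of_apply, ← sum_dilation_mul_mul]
      rw [Matrix.mul_apply, Fintype.sum_prod_type]
      refine Finset.sum_congr rfl fun b _ => Finset.sum_congr rfl fun κ _ => ?_
      simp [V, Matrix.mul_apply, Matrix.single_apply, ite_and]
    rw [h1, hα]
    by_cases h : c = c' <;> simp [h, Matrix.trace_single_eq_of_ne, Matrix.trace_single_eq_same]
  have hpos : α.PosSemidef := by
    have := Matrix.posSemidef_self_mul_conjTranspose (V 0)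
    rwa [hV, if_pos rfl] at this
  obtain ⟨r, Ψ, U, hU, h⟩ := exists_isometry_factor V hpos hV
  exact ⟨r, Ψ, U, hU, fun a y c => h a y c⟩

end QOTT

lemma sqrt_mul_sqrt_natCast (n : ℕ) :
    ((Real.sqrt n : ℝ) : ℂ)⁻¹ * ((Real.sqrt n : ℝ) : ℂ)⁻¹ = (n : ℂ)⁻¹ := by
  rw [← mul_inv, ← Complex.ofReal_mul, Real.mul_self_sqrt (Nat.cast_nonneg n)]
  simp

/-! ### The ancilla Ψ and teleportation by an honest commitment. -/

section Ancilla

variable {A : Type*} {r d : ℕ} [NeZero d] {Ψ : A × Fin r → ℂ}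

/-- The operator `C → A S' C`, `ψ ↦ Ψ ⊗ ψ`. -/
noncomputable def adjoinAncilla (d : ℕ) (Ψ : A × Fin r → ℂ) :
    Matrix (A × (Fin r × ZMod d)) (ZMod d) ℂ :=
  Matrix.of fun x c => if x.2.2 = c then Ψ (x.1, x.2.1) else 0

lemma conjTranspose_adjoinAncilla_mul_mul_apply [Fintype A]
    (σ : Matrix (A × (Fin r × ZMod d)) (A × (Fin r × ZMod d)) ℂ) (c c' : ZMod d) :
    ((adjoinAncilla d Ψ)ᴴ * σ * adjoinAncilla d Ψ) c c' = ∑ y : A × Fin r, ∑ y' : A × Fin r,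
      star (Ψ y) * σ (y.1, (y.2, c)) (y'.1, (y'.2, c')) * Ψ y' := by
  rw [Matrix.mul_apply, Finset.sum_comm]
  simp only [Matrix.mul_apply, adjoinAncilla, Matrix.of_apply, Fintype.sum_prod_type,
    Matrix.conjTranspose_apply, apply_ite star, star_zero, ite_mul, zero_mul, mul_ite, mul_zero,
    Finset.sum_ite_eq', Finset.mem_univ, if_true, Finset.sum_mul]

lemma conjTranspose_adjoinAncilla_mul_self [Fintype A] :
    (adjoinAncilla d Ψ)ᴴ * adjoinAncilla d Ψ = (dyad Ψ).trace • 1 := by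
  ext c c'
  simp [Matrix.mul_apply, adjoinAncilla, Fintype.sum_prod_type, trace_dyad, Matrix.one_apply,
    apply_ite (starRingEnd ℂ), Finset.sum_ite_irrel, mul_comm, eq_comm]

end Ancilla

section HonestCommit

variable {d : ℕ} [NeZero d] {A R : Type*}

/-- An honest commitment teleports the secret, up to a Weyl operator, into an isometry `F`
applied to half of the maximally entangled state. -/
lemma ampliate_honestCommit (ρ : Matrix (ZMod d) (ZMod d) ℂ) (m : ZMod d × ZMod d)
    (F : Matrix (A × R) (ZMod d) ℂ) :
    ampliate (honestCommit ρ m) (dyad fun x : (ZMod d × A) × R =>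
      ((Real.sqrt d : ℝ) : ℂ)⁻¹ * F (x.1.2, x.2) x.1.1) =
      ((d : ℂ) ^ 2)⁻¹ • (F * ((weyl m.1 m.2)ᴴ * ρ * weyl m.1 m.2) * Fᴴ) := by
  ext ⟨a, y⟩ ⟨a', y'⟩
  have hd : ((d : ℂ) ^ 2)⁻¹ = ((Real.sqrt d : ℝ) : ℂ)⁻¹ * ((Real.sqrt d : ℝ) : ℂ)⁻¹ *
      (((Real.sqrt d : ℝ) : ℂ)⁻¹ * ((Real.sqrt d : ℝ) : ℂ)⁻¹) := by
    rw [sqrt_mul_sqrt_natCast, ← mul_inv, sq]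
  rw [hd]
  simp only [ampliate, honestCommit, LinearMap.coe_mk, AddHom.coe_mk, Matrix.of_apply, dyad_apply,
    bell_apply, star_mul, star_inv₀, Complex.star_def, Complex.conj_ofReal, Matrix.smul_apply,
    smul_eq_mul, Matrix.mul_apply, Matrix.conjTranspose_apply, Finset.mul_sum, Finset.sum_mul]
  refine Finset.sum_comm.trans (Eq.trans ?_ Finset.sum_comm)
  refine Finset.sum_congr rfl fun e _ => ?_
  rw [Finset.sum_comm' (s' := fun _ => Finset.univ) (t' := Finset.univ) (by simp)]
  refine (Finset.sum_congr rfl fun x' _ => Finset.sum_comm).trans ?_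
  refine Finset.sum_comm.trans ?_
  refine Finset.sum_congr rfl fun e' _ => Finset.sum_congr rfl fun x' _ =>
    Finset.sum_congr rfl fun x _ => ?_
  ring

end HonestCommit

/-! ### Removing the key encryption, and delayed teleportation. -/

namespace QOTT

variable {d p : ℕ} [NeZero d] [Fact p.Prime] {A B S : Type*}
    [Fintype A] [DecidableEq A] [Fintype B] [DecidableEq B] [Fintype S] [DecidableEq S]
    (T : QOTT d p A B S)

/-- The state distributed in `SETUP` before the key is encrypted. -/
noncomputable def plainSetup : (ZMod d × A) × (B × ZMod p) → ℂ := fun x =>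
  ((Real.sqrt d : ℝ) : ℂ)⁻¹ * T.dilation (x.1.2, x.2) x.1.1

lemma setup_eq (i j : ZMod p × ZMod p) :
    T.setup i j = ((1 : Matrix (ZMod d × A) (ZMod d × A) ℂ) ⊗ₖ
      ((1 : Matrix B B ℂ) ⊗ₖ weyl (j.1 * i.1) (j.2 * i.2))) *ᵥ T.plainSetup := by
  ext ⟨⟨e, a⟩, ⟨b, κ⟩⟩
  have h : (((1 : Matrix (ZMod d × A) (ZMod d × A) ℂ) ⊗ₖ
      ((1 : Matrix B B ℂ) ⊗ₖ weyl (j.1 * i.1) (j.2 * i.2))) *ᵥ T.plainSetup) ((e, a), (b, κ)) =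
      ∑ κ', weyl (j.1 * i.1) (j.2 * i.2) κ κ' * T.plainSetup ((e, a), (b, κ')) := by
    simp [Matrix.mulVec, dotProduct, Fintype.sum_prod_type, Matrix.one_apply,
      Finset.sum_ite_irrel]
  rw [h]
  simp only [setup, plainSetup, dilation_apply, maxEnt, ite_mul, zero_mul, mul_ite, mul_zero,
    Finset.sum_ite_irrel, Finset.sum_const_zero, Finset.sum_ite_eq, Finset.mem_univ, if_true,
    Finset.mul_sum]
  rw [Finset.sum_comm]
  exact Finset.sum_congr rfl fun κ' _ => Finset.sum_congr rfl fun s _ => by ring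

lemma dyad_setup (i j : ZMod p × ZMod p) :
    dyad (T.setup i j) = ((1 : Matrix (ZMod d × A) (ZMod d × A) ℂ) ⊗ₖ
      ((1 : Matrix B B ℂ) ⊗ₖ weyl (j.1 * i.1) (j.2 * i.2))) * dyad T.plainSetup *
      ((1 : Matrix (ZMod d × A) (ZMod d × A) ℂ) ⊗ₖ
      ((1 : Matrix B B ℂ) ⊗ₖ (weyl (j.1 * i.1) (j.2 * i.2))ᴴ)) := by
  rw [setup_eq, dyad_mulVec]
  simp [Matrix.conjTranspose_kronecker]

lemma revealOp_eq (j k : ZMod p × ZMod p) (m : ZMod d × ZMod d) :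
    T.revealOp j k m = weyl m.1 m.2 * (((1 : Matrix A A ℂ) ⊗ₖ
      ((1 : Matrix B B ℂ) ⊗ₖ weyl (j.1 * k.1) (j.2 * k.2))) * T.dilation)ᴴ := by
  rw [revealOp]
  congr 1
  ext c ⟨a, b, κ⟩
  rw [Matrix.conjTranspose_apply, one_kronecker_mul_dilation_apply]
  simp only [Matrix.of_apply, pauliZ_pow_mul_pauliX_pow, dilation_apply, star_sum, star_mul,
    Finset.sum_mul, Matrix.conjTranspose_apply]
  rw [Finset.sum_comm]

/-- The operator `C → ABK` whose adjoint is Bob's check when Alice holds `i` and reports `k`, with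
the encryption of the key undone. -/
noncomputable def checkOp (i j k : ZMod p × ZMod p) : Matrix (A × (B × ZMod p)) (ZMod d) ℂ :=
  ((1 : Matrix A A ℂ) ⊗ₖ ((1 : Matrix B B ℂ) ⊗ₖ
    ((weyl (j.1 * i.1) (j.2 * i.2))ᴴ * weyl (j.1 * k.1) (j.2 * k.2)))) * T.dilation

lemma checkOp_self (i j : ZMod p × ZMod p) : T.checkOp i j i = T.dilation := by
  simp [checkOp, conjTranspose_weyl_mul_self]

lemma ampliate_committed {A' : Type*} [Fintype A']
    (Δ : ZMod d × ZMod d → (Matrix (ZMod d × A) (ZMod d × A) ℂ →ₗ[ℂ] Matrix A' A' ℂ))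
    (Ξ : Matrix A' A' ℂ →ₗ[ℂ] Matrix A A ℂ) (i j : ZMod p × ZMod p) (m : ZMod d × ZMod d) :
    ampliate Ξ (T.committed Δ i j m) = ((1 : Matrix A A ℂ) ⊗ₖ
      ((1 : Matrix B B ℂ) ⊗ₖ weyl (j.1 * i.1) (j.2 * i.2))) *
      ampliate Ξ (ampliate (Δ m) (dyad T.plainSetup)) *
      ((1 : Matrix A A ℂ) ⊗ₖ ((1 : Matrix B B ℂ) ⊗ₖ (weyl (j.1 * i.1) (j.2 * i.2))ᴴ)) := by
  classical
  rw [committed, dyad_setup, ampliate_one_kronecker_mul_mul, ampliate_one_kronecker_mul_mul]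

/-- Encryption acts on Bob's side alone, so it passes through Δ and Ξ and is absorbed into the
check. The state τ left in the middle involves none of the indices i, j, which makes checks for
different j comparable on one state. -/
lemma accepted_eq {A' : Type*} [Fintype A']
    (Δ : ZMod d × ZMod d → (Matrix (ZMod d × A) (ZMod d × A) ℂ →ₗ[ℂ] Matrix A' A' ℂ))
    (Ξ : Matrix A' A' ℂ →ₗ[ℂ] Matrix A A ℂ) (i j k : ZMod p × ZMod p) (m : ZMod d × ZMod d) :
    T.accepted Δ Ξ i j k m = weyl m.1 m.2 * ((T.checkOp i j k)ᴴ *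
      ampliate Ξ (ampliate (Δ m) (dyad T.plainSetup)) * T.checkOp i j k) *
      (weyl m.1 m.2)ᴴ := by
  have h : T.checkOp i j k = ((1 : Matrix A A ℂ) ⊗ₖ ((1 : Matrix B B ℂ) ⊗ₖ
      (weyl (j.1 * i.1) (j.2 * i.2))ᴴ)) * (((1 : Matrix A A ℂ) ⊗ₖ
      ((1 : Matrix B B ℂ) ⊗ₖ weyl (j.1 * k.1) (j.2 * k.2))) * T.dilation) := by
    rw [checkOp, ← Matrix.mul_assoc, ← Matrix.mul_kronecker_mul, ← Matrix.mul_kronecker_mul,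
      Matrix.mul_one, Matrix.mul_one]
  rw [accepted, ampliate_committed, revealOp_eq, h]
  simp only [Matrix.conjTranspose_mul, Matrix.conjTranspose_kronecker,
    Matrix.conjTranspose_conjTranspose, Matrix.conjTranspose_one, Matrix.mul_assoc]

section Alice

variable {r : ℕ} {Ψ : A × Fin r → ℂ} {U : Matrix (B × ZMod p) (Fin r × ZMod d) ℂ}

lemma dilation_eq_mul_adjoinAncilla
    (h : ∀ a y c, T.dilation (a, y) c = ∑ t, Ψ (a, t) * U y (t, c)) :
    T.dilation = ((1 : Matrix A A ℂ) ⊗ₖ U) * adjoinAncilla d Ψ := by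
  ext ⟨a, y⟩ c
  rw [h, Matrix.mul_apply]
  simp [adjoinAncilla, Fintype.sum_prod_type, Matrix.one_apply, Finset.sum_ite_irrel, mul_comm]

lemma trace_dyad_ancilla (hU : Uᴴ * U = 1)
    (h : ∀ a y c, T.dilation (a, y) c = ∑ t, Ψ (a, t) * U y (t, c)) : (dyad Ψ).trace = 1 := by
  have h1 := T.conjTranspose_dilation_mul_self
  rw [T.dilation_eq_mul_adjoinAncilla h, Matrix.conjTranspose_mul, Matrix.mul_assoc,
    ← Matrix.mul_assoc (_ᴴ) (_ ⊗ₖ _), Matrix.conjTranspose_kronecker, ← Matrix.mul_kronecker_mul,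
    hU, Matrix.conjTranspose_one, Matrix.one_mul, Matrix.one_kronecker_one, Matrix.one_mul,
    conjTranspose_adjoinAncilla_mul_self] at h1
  simpa using congrFun (congrFun h1 0) 0

/-- With the true indices, the accepted state is the output of delayed teleportation. -/
lemma accepted_self_eq_delayedTeleportation (hU : Uᴴ * U = 1)
    (h : ∀ a y c, T.dilation (a, y) c = ∑ t, Ψ (a, t) * U y (t, c))
    {A' : Type*} [Fintype A']
    (Δ : ZMod d × ZMod d → (Matrix (ZMod d × A) (ZMod d × A) ℂ →ₗ[ℂ] Matrix A' A' ℂ))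
    (Ξ : Matrix A' A' ℂ →ₗ[ℂ] Matrix A A ℂ) (i j : ZMod p × ZMod p) (m : ZMod d × ZMod d) :
    T.accepted Δ Ξ i j i m = delayedTeleportation Ψ Δ Ξ Ψ m := by
  classical
  rw [accepted_eq, checkOp_self, delayedTeleportation]
  congr 2
  ext c c'
  rw [Matrix.of_apply, ← conjTranspose_adjoinAncilla_mul_mul_apply]
  -- The distributed state is Θ ⊗ Ψ with U applied on Bob's side; U commutes with Alice's maps and
  -- meets U† from the check.
  have hs : T.plainSetup = ((1 : Matrix (ZMod d × A) (ZMod d × A) ℂ) ⊗ₖ U) *ᵥ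
      fun x => maxEnt (x.1.1, x.2.2) * Ψ (x.1.2, x.2.1) := by
    ext ⟨⟨e, a⟩, y⟩
    simp [plainSetup, h, Matrix.mulVec, dotProduct, Fintype.sum_prod_type, Matrix.one_apply,
      Finset.sum_ite_irrel, maxEnt, Finset.mul_sum]
    exact Finset.sum_congr rfl fun t _ => by ring
  rw [hs, dyad_mulVec, Matrix.conjTranspose_kronecker, Matrix.conjTranspose_one,
    ampliate_one_kronecker_mul_mul, ampliate_one_kronecker_mul_mul,
    T.dilation_eq_mul_adjoinAncilla h]
  have hk : ((1 : Matrix A A ℂ) ⊗ₖ Uᴴ) * ((1 : Matrix A A ℂ) ⊗ₖ U) = 1 := by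
    rw [← Matrix.mul_kronecker_mul, hU, Matrix.one_mul, Matrix.one_kronecker_one]
  simp only [Matrix.conjTranspose_mul, Matrix.conjTranspose_kronecker, Matrix.conjTranspose_one,
    Matrix.mul_assoc]
  rw [← Matrix.mul_assoc (_ ⊗ₖ Uᴴ) (_ ⊗ₖ U), hk, Matrix.one_mul,
    ← Matrix.mul_assoc (_ ⊗ₖ Uᴴ) (_ ⊗ₖ U), hk, Matrix.one_mul]

end Alice

end QOTT

/-- After the Bell measurement C carries the Weyl-rotated secret in a product with Ψ. Ξ touches only
Ψ, so projecting back contributes a scalar, and Bob's correction undoes the rotation. -/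
lemma delayedTeleportation_honestCommit {d : ℕ} [NeZero d] {A : Type*} [Fintype A] {r : ℕ}
    (Ψ : A × Fin r → ℂ) (ρ : Matrix (ZMod d) (ZMod d) ℂ)
    (Ξ : Matrix A A ℂ →ₗ[ℂ] Matrix A A ℂ) (m : ZMod d × ZMod d) :
    delayedTeleportation Ψ (honestCommit ρ) Ξ Ψ m =
      (((d : ℂ) ^ 2)⁻¹ * (star Ψ ⬝ᵥ Matrix.mulVec (ampliate Ξ (dyad Ψ)) Ψ)) • ρ := by
  have h0 : (fun x : (ZMod d × A) × (Fin r × ZMod d) =>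
      maxEnt (x.1.1, x.2.2) * Ψ (x.1.2, x.2.1)) =
      fun x => ((Real.sqrt d : ℝ) : ℂ)⁻¹ * adjoinAncilla d Ψ (x.1.2, x.2) x.1.1 := by
    ext x
    simp [maxEnt, adjoinAncilla, eq_comm]
  set ρ' := (weyl m.1 m.2)ᴴ * ρ * weyl m.1 m.2 with hρ'
  have h1 (a a' : A) (t t' : Fin r) (c c' : ZMod d) :
      (adjoinAncilla d Ψ * ρ' * (adjoinAncilla d Ψ)ᴴ) (a, (t, c)) (a', (t', c')) =
        ρ' c c' * dyad Ψ (a, t) (a', t') := by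
    simp [Matrix.mul_apply, adjoinAncilla, dyad_apply, apply_ite (starRingEnd ℂ)]
    ring
  have h2 (a a' : A) (t t' : Fin r) (c c' : ZMod d) :
      ampliate Ξ (adjoinAncilla d Ψ * ρ' * (adjoinAncilla d Ψ)ᴴ) (a, (t, c)) (a', (t', c')) =
        ρ' c c' * ampliate Ξ (dyad Ψ) (a, t) (a', t') := by
    have : (Matrix.of fun x x' => (adjoinAncilla d Ψ * ρ' * (adjoinAncilla d Ψ)ᴴ)
        (x, (t, c)) (x', (t', c'))) =
        ρ' c c' • Matrix.of fun x x' => dyad Ψ (x, t) (x', t') := by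
      ext; simp [h1]
    simp only [ampliate, Matrix.of_apply, this, map_smul]
    rfl
  have h3 : (adjoinAncilla d Ψ)ᴴ *
      ampliate Ξ (ampliate (honestCommit ρ m) (dyad fun x : (ZMod d × A) × (Fin r × ZMod d) =>
      maxEnt (x.1.1, x.2.2) * Ψ (x.1.2, x.2.1))) * adjoinAncilla d Ψ =
      (((d : ℂ) ^ 2)⁻¹ * (star Ψ ⬝ᵥ Matrix.mulVec (ampliate Ξ (dyad Ψ)) Ψ)) • ρ' := by
    rw [h0, ampliate_honestCommit, ← hρ', ampliate_smul, Matrix.mul_smul, Matrix.smul_mul, mul_smul]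
    congr 1
    ext c c'
    rw [conjTranspose_adjoinAncilla_mul_mul_apply]
    simp only [h2, Matrix.smul_apply, smul_eq_mul, dotProduct, Matrix.mulVec, Finset.sum_mul,
      Finset.mul_sum, Pi.star_apply]
    exact Finset.sum_congr rfl fun y _ => Finset.sum_congr rfl fun y' _ => by ring
  have h4 : weyl m.1 m.2 * ρ' * (weyl m.1 m.2)ᴴ = ρ := by
    have h := weyl_mul_conjTranspose_self m.1 m.2
    rw [hρ', Matrix.mul_assoc, Matrix.mul_assoc, Matrix.mul_assoc, h, Matrix.mul_one,
      ← Matrix.mul_assoc, h, Matrix.one_mul]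
  rw [← h4, ← Matrix.smul_mul, ← Matrix.mul_smul, h4, ← h3]
  rw [delayedTeleportation]
  congr 2
  ext c c'
  rw [Matrix.of_apply, conjTranspose_adjoinAncilla_mul_mul_apply]

lemma star_dotProduct_dyad_mulVec {X : Type*} [Fintype X] (v : X → ℂ) :
    star v ⬝ᵥ (dyad v *ᵥ v) = (dyad v).trace * (dyad v).trace := by
  rw [dyad, Matrix.vecMulVec_mulVec, Matrix.trace_vecMulVec]
  simp [dotProduct_comm]

lemma ampliate_id {X R : Type*} (σ : Matrix (X × R) (X × R) ℂ) :
    ampliate LinearMap.id σ = σ := rfl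

namespace QOTT

variable {d p : ℕ} [NeZero d] [Fact p.Prime] {A B S : Type*}
    [Fintype A] [DecidableEq A] [Fintype B] [DecidableEq B] [Fintype S] [DecidableEq S]
    (T : QOTT d p A B S)

/-! ### Concealment against Bob. -/

section Bob

lemma ptrLeft_committed_honestCommit (ρ : Matrix (ZMod d) (ZMod d) ℂ)
    (i j : ZMod p × ZMod p) (m : ZMod d × ZMod d) (b b' : B) (κ κ' : ZMod p) :
    ptrLeft (T.committed (honestCommit ρ) i j m) (b, κ) (b', κ') =
      ((d : ℂ) ^ 2)⁻¹ * ∑ μ, ∑ ν, (weyl (j.1 * i.1) (j.2 * i.2) κ μ *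
        star (weyl (j.1 * i.1) (j.2 * i.2) κ' ν)) *
        ∑ a, (T.dilation * ((weyl m.1 m.2)ᴴ * ρ * weyl m.1 m.2) * T.dilationᴴ)
          (a, (b, μ)) (a, (b', ν)) := by
  have h : T.committed (honestCommit ρ) i j m = ((d : ℂ) ^ 2)⁻¹ • (((1 : Matrix A A ℂ) ⊗ₖ
      ((1 : Matrix B B ℂ) ⊗ₖ weyl (j.1 * i.1) (j.2 * i.2))) *
      (T.dilation * ((weyl m.1 m.2)ᴴ * ρ * weyl m.1 m.2) * T.dilationᴴ) *
      ((1 : Matrix A A ℂ) ⊗ₖ ((1 : Matrix B B ℂ) ⊗ₖ (weyl (j.1 * i.1) (j.2 * i.2))ᴴ))) := by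
    rw [← ampliate_id (T.committed _ _ _ _), ampliate_committed, ampliate_id]
    have := ampliate_honestCommit ρ m T.dilation
    unfold plainSetup
    rw [this, Matrix.mul_smul, Matrix.smul_mul]
  rw [h]
  simp only [ptrLeft, Matrix.of_apply, Matrix.smul_apply, smul_eq_mul, ← Finset.mul_sum,
    one_kronecker_mul_mul_apply]
  congr 1
  have h2 (a : A) : ∑ s : B × ZMod p, ∑ t : B × ZMod p,
      (((1 : Matrix B B ℂ) ⊗ₖ weyl (j.1 * i.1) (j.2 * i.2)) (b, κ) s *
        ((1 : Matrix B B ℂ) ⊗ₖ (weyl (j.1 * i.1) (j.2 * i.2))ᴴ) t (b', κ')) *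
        (T.dilation * ((weyl m.1 m.2)ᴴ * ρ * weyl m.1 m.2) * T.dilationᴴ) (a, s) (a, t) =
      ∑ μ, ∑ ν, (weyl (j.1 * i.1) (j.2 * i.2) κ μ *
        star (weyl (j.1 * i.1) (j.2 * i.2) κ' ν)) *
        (T.dilation * ((weyl m.1 m.2)ᴴ * ρ * weyl m.1 m.2) * T.dilationᴴ)
          (a, (b, μ)) (a, (b', ν)) := by
    generalize T.dilation * ((weyl m.1 m.2)ᴴ * ρ * weyl m.1 m.2) * T.dilationᴴ = τ
    simp [Fintype.sum_prod_type, Matrix.one_apply, Finset.sum_ite_irrel]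
  simp only [h2]
  rw [Finset.sum_comm]
  refine Finset.sum_congr rfl fun μ _ => ?_
  rw [Finset.sum_comm]
  simp only [Finset.mul_sum]

/-- For nonzero `j`, the encryption by a uniformly random index is the full Weyl twirl. -/
lemma sum_weyl_index {j : ZMod p × ZMod p} (h1 : j.1 ≠ 0) (h2 : j.2 ≠ 0)
    (f : ZMod p × ZMod p → ℂ) :
    ∑ i : ZMod p × ZMod p, f (j.1 * i.1, j.2 * i.2) = ∑ g, f g :=
  ((Equiv.mulLeft₀ j.1 h1).prodCongr (Equiv.mulLeft₀ j.2 h2)).sum_comp f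

lemma bobView_eq {β : Matrix B B ℂ}
    (hβ : ∀ ρ : Matrix (ZMod d) (ZMod d) ℂ, IsDensity ρ →
      ptrLeft (T.M * (ρ ⊗ₖ T.safe) * T.Mᴴ) = β)
    {ρ : Matrix (ZMod d) (ZMod d) ℂ} (hρ : IsDensity ρ) {j : ZMod p × ZMod p}
    (hj : j ∈ T.J ×ˢ T.J) (m : ZMod d × ZMod d) :
    T.bobView ρ j m = ((d : ℂ) ^ 2)⁻¹ •
      Matrix.kronecker β ((p : ℂ)⁻¹ • (1 : Matrix (ZMod p) (ZMod p) ℂ)) := by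
  have hp : (p : ℂ) ≠ 0 := Nat.cast_ne_zero.2 (Fact.out : p.Prime).ne_zero
  rw [Finset.mem_product] at hj
  have h1 : j.1 ≠ 0 := fun h => T.zero_notMem (h ▸ hj.1)
  have h2 : j.2 ≠ 0 := fun h => T.zero_notMem (h ▸ hj.2)
  have hρ' : IsDensity ((weyl m.1 m.2)ᴴ * ρ * weyl m.1 m.2) := by
    refine ⟨hρ.1.conjTranspose_mul_mul_same _, ?_⟩
    rw [Matrix.mul_assoc, Matrix.trace_mul_comm, Matrix.mul_assoc, weyl_mul_conjTranspose_self,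
      Matrix.mul_one, hρ.2]
  ext ⟨b, κ⟩ ⟨b', κ'⟩
  have h3 : β b b' = ∑ μ, ∑ a, (T.dilation * ((weyl m.1 m.2)ᴴ * ρ * weyl m.1 m.2) *
      T.dilationᴴ) (a, (b, μ)) (a, (b', μ)) := by
    rw [← hβ _ hρ', Finset.sum_comm]
    simp only [sum_dilation_mul_mul, ptrLeft, Matrix.of_apply]
  simp only [bobView, Matrix.smul_apply, Matrix.sum_apply, ptrLeft_committed_honestCommit,
    smul_eq_mul, ← Finset.mul_sum, Matrix.kronecker, Matrix.kroneckerMap_apply]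
  rw [sum_weyl_index h1 h2 fun g => ∑ μ, ∑ ν, (weyl g.1 g.2 κ μ * star (weyl g.1 g.2 κ' ν)) *
        ∑ a, (T.dilation * ((weyl m.1 m.2)ᴴ * ρ * weyl m.1 m.2) * T.dilationᴴ)
          (a, (b, μ)) (a, (b', ν)), Finset.sum_comm]
  -- The twirl keeps only μ = ν, which traces out the old key and leaves the identity on K.
  have h4 (μ : ZMod p) (F : ZMod p → ℂ) : ∑ g : ZMod p × ZMod p, ∑ ν,
      (weyl g.1 g.2 κ μ * star (weyl g.1 g.2 κ' ν)) * F ν =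
      if κ = κ' then p * F μ else 0 := by
    rw [Finset.sum_comm]
    simp only [← Finset.sum_mul, sum_weyl_mul_star_weyl, ite_and, ite_mul, zero_mul,
      Finset.sum_ite_irrel, Finset.sum_ite_eq, Finset.mem_univ, if_true, Finset.sum_const_zero]
  rw [Finset.sum_congr rfl fun μ _ => h4 μ _]
  rw [Finset.sum_ite_irrel, ← Finset.mul_sum, ← h3]
  by_cases hκ : κ = κ'
  · subst hκ
    simp
    field_simp
  · simp [hκ]

lemma exists_density_ptrLeft_mask : ∃ β : Matrix B B ℂ, IsDensity β ∧
    ∀ ρ : Matrix (ZMod d) (ZMod d) ℂ, IsDensity ρ →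
      ptrLeft (T.M * (ρ ⊗ₖ T.safe) * T.Mᴴ) = β := by
  obtain ⟨β, hβ⟩ := T.masks.2.1
  refine ⟨β, ?_, hβ⟩
  obtain ⟨ρ, hρ⟩ : ∃ ρ : Matrix (ZMod d) (ZMod d) ℂ, IsDensity ρ :=
    ⟨dyad (Pi.single 0 1), posSemidef_dyad _, by simp [trace_dyad, Pi.single_apply]⟩
  have hβρ : ptrLeft (T.M * (ρ ⊗ₖ T.safe) * T.Mᴴ) = β := hβ _ hρ
  rw [← hβρ]
  set σ := T.M * (ρ ⊗ₖ T.safe) * T.Mᴴ with hσ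
  have h1 : σ.PosSemidef := (hρ.1.kronecker T.safe_density.1).mul_mul_conjTranspose_same _
  have h2 : σ.trace = 1 := by
    rw [hσ, Matrix.trace_mul_comm, ← Matrix.mul_assoc, T.isometry, Matrix.one_mul,
      Matrix.trace_kronecker, hρ.2, T.safe_density.2, one_mul]
  constructor
  · have : ptrLeft σ = ∑ a, σ.submatrix (fun b => (a, b)) (fun b => (a, b)) := by
      ext b b'; simp [ptrLeft, Matrix.sum_apply]
    rw [this]
    exact Matrix.posSemidef_sum _ fun a _ => h1.submatrix _
  · rw [← h2]
    simp only [Matrix.trace, Matrix.diag_apply, ptrLeft, Matrix.of_apply, Fintype.sum_prod_type]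
    exact Finset.sum_comm

end Bob

/-! ### Orthogonality of the checks under wrong indices. -/

section WrongIndices

lemma conjTranspose_checkOp_mul (i j k l : ZMod p × ZMod p) :
    (T.checkOp i j k)ᴴ * T.checkOp i l k =
      ((((weyl (j.1 * k.1) (j.2 * k.2))ᴴ * weyl (j.1 * i.1) (j.2 * i.2)) *
        ((weyl (l.1 * i.1) (l.2 * i.2))ᴴ * weyl (l.1 * k.1) (l.2 * k.2))).trace * (p : ℂ)⁻¹) •
        1 := by
  have h (N N' : Matrix (ZMod p) (ZMod p) ℂ) :
      (((1 : Matrix A A ℂ) ⊗ₖ ((1 : Matrix B B ℂ) ⊗ₖ N)) * T.dilation)ᴴ *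
        (((1 : Matrix A A ℂ) ⊗ₖ ((1 : Matrix B B ℂ) ⊗ₖ N')) * T.dilation) =
      ((Nᴴ * N').trace * (p : ℂ)⁻¹) • 1 := by
    have h1 : ((1 : Matrix A A ℂ) ⊗ₖ ((1 : Matrix B B ℂ) ⊗ₖ (Nᴴ * N'))) =
        ((1 : Matrix A A ℂ) ⊗ₖ ((1 : Matrix B B ℂ) ⊗ₖ N))ᴴ *
          ((1 : Matrix A A ℂ) ⊗ₖ ((1 : Matrix B B ℂ) ⊗ₖ N')) := by
      rw [Matrix.conjTranspose_kronecker, Matrix.conjTranspose_kronecker,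
        Matrix.conjTranspose_one, Matrix.conjTranspose_one, ← Matrix.mul_kronecker_mul,
        ← Matrix.mul_kronecker_mul, Matrix.one_mul, Matrix.one_mul]
    rw [← T.conjTranspose_dilation_mul_mul, h1, Matrix.conjTranspose_mul, Matrix.mul_assoc,
      Matrix.mul_assoc]
  rw [checkOp, checkOp, h, Matrix.conjTranspose_mul, Matrix.conjTranspose_conjTranspose]

lemma conjTranspose_checkOp_mul_self (i j k : ZMod p × ZMod p) :
    (T.checkOp i j k)ᴴ * T.checkOp i j k = 1 := by
  have hp : (p : ℂ) ≠ 0 := Nat.cast_ne_zero.2 (Fact.out : p.Prime).ne_zero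
  rw [conjTranspose_checkOp_mul]
  rw [Matrix.mul_assoc, ← Matrix.mul_assoc (weyl (j.1 * i.1) _), weyl_mul_conjTranspose_self,
    Matrix.one_mul, conjTranspose_weyl_mul_self]
  simp [ZMod.card, hp]

lemma conjTranspose_checkOp_mul_eq_zero {i j k l : ZMod p × ZMod p}
    (h : (j.1 ≠ l.1 ∧ i.1 ≠ k.1) ∨ (j.2 ≠ l.2 ∧ i.2 ≠ k.2)) :
    (T.checkOp i j k)ᴴ * T.checkOp i l k = 0 := by
  rw [conjTranspose_checkOp_mul, trace_weyl_four_eq_zero]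
  · simp
  -- The total exponent in each coordinate factors as (j - l)(i - k), nonzero because `ZMod p` is a
  -- field.
  · have e (x y u v : ZMod p) : -(x * v) + x * u - y * u + y * v = (x - y) * (u - v) := by ring
    rw [e, e]
    exact h.imp (fun h => mul_ne_zero (sub_ne_zero.2 h.1) (sub_ne_zero.2 h.2))
      fun h => mul_ne_zero (sub_ne_zero.2 h.1) (sub_ne_zero.2 h.2)

/-- For each wrong report, at most a fraction `1 / |J|` of the checks can succeed. -/
lemma sum_trace_checkOp_le {i k : ZMod p × ZMod p} (hk : k ≠ i)
    {τ : Matrix (A × (B × ZMod p)) (A × (B × ZMod p)) ℂ} (hτ : τ.PosSemidef) :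
    ∑ j ∈ T.J ×ˢ T.J, ((T.checkOp i j k)ᴴ * τ * T.checkOp i j k).trace.re ≤
      T.J.card * τ.trace.re := by
  have hne : i.1 ≠ k.1 ∨ i.2 ≠ k.2 := by
    by_contra! h
    exact hk (Prod.ext h.1.symm h.2.symm)
  rw [← nsmul_eq_mul]
  rcases hne with h | h
  -- Bessel is applied in the coordinate where the report is wrong; the other coordinate is only
  -- counted, giving the factor |J|.
  · rw [Finset.sum_product_right]
    refine Finset.sum_le_card_nsmul _ _ _ fun y _ => ?_
    refine sum_trace_conjTranspose_mul_mul_le T.J (fun x => T.checkOp i (x, y) k)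
      (fun x _ x' _ => ?_) hτ
    split_ifs with hx
    · rw [hx, conjTranspose_checkOp_mul_self]
    · exact T.conjTranspose_checkOp_mul_eq_zero (.inl ⟨hx, h⟩)
  · rw [Finset.sum_product]
    refine Finset.sum_le_card_nsmul _ _ _ fun x _ => ?_
    refine sum_trace_conjTranspose_mul_mul_le T.J (fun y => T.checkOp i (x, y) k)
      (fun y _ y' _ => ?_) hτ
    split_ifs with hy
    · rw [hy, conjTranspose_checkOp_mul_self]
    · exact T.conjTranspose_checkOp_mul_eq_zero (.inr ⟨hy, h⟩)

lemma trace_dyad_plainSetup : (dyad T.plainSetup).trace = 1 := by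
  have h := congrArg Matrix.trace T.conjTranspose_dilation_mul_self
  have hd : (d : ℂ) ≠ 0 := Nat.cast_ne_zero.2 (NeZero.ne d)
  have h1 : (dyad T.plainSetup).trace = (d : ℂ)⁻¹ * (T.dilationᴴ * T.dilation).trace := by
    rw [trace_dyad, Fintype.sum_prod_type, Fintype.sum_prod_type, Matrix.trace, Finset.mul_sum]
    refine Finset.sum_congr rfl fun e _ => ?_
    rw [Matrix.diag_apply, Matrix.mul_apply, Finset.mul_sum, Fintype.sum_prod_type]
    refine Finset.sum_congr rfl fun a _ => Finset.sum_congr rfl fun y _ => ?_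
    rw [← sqrt_mul_sqrt_natCast]
    simp [plainSetup]
    ring
  rw [h1, h]
  simp [ZMod.card, hd]

lemma sum_passProb_le {A' : Type*} [Fintype A']
    {Δ : ZMod d × ZMod d → (Matrix (ZMod d × A) (ZMod d × A) ℂ →ₗ[ℂ] Matrix A' A' ℂ)}
    {Ξ : ZMod p × ZMod p → (Matrix A' A' ℂ →ₗ[ℂ] Matrix A A ℂ)}
    (hΔ : IsInstrument Δ) (hΞ : IsInstrument Ξ) (i : ZMod p × ZMod p) :
    ∑ k ∈ Finset.univ.erase i, T.passProb Δ (Ξ k) i k ≤ 1 / (T.J.card : ℝ) := by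
  have hJ : (0 : ℝ) < T.J.card := by
    have := T.two_le_card
    exact_mod_cast (by omega : 0 < T.J.card)
  let τ (k : ZMod p × ZMod p) (m : ZMod d × ZMod d) :=
    ampliate (Ξ k) (ampliate (Δ m) (dyad T.plainSetup))
  have hτ (k m) : (τ k m).PosSemidef :=
    (hΞ.1 k).posSemidef_ampliate ((hΔ.1 m).posSemidef_ampliate (posSemidef_dyad _))
  have htr (j k m) : (T.accepted Δ (Ξ k) i j k m).trace =
      ((T.checkOp i j k)ᴴ * τ k m * T.checkOp i j k).trace := by
    rw [accepted_eq, Matrix.trace_mul_comm, ← Matrix.mul_assoc, conjTranspose_weyl_mul_self,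
      Matrix.one_mul]
  -- The weights of the pairs (k, m) form a probability distribution, so the bounds for the separate
  -- wrong reports add up without a union-bound loss.
  have hsum : ∑ k, ∑ m, (τ k m).trace.re = 1 := by
    have : ∑ k, ∑ m, (τ k m).trace = 1 := by
      rw [Finset.sum_comm]
      simp only [τ, hΞ.sum_trace_ampliate, hΔ.sum_trace_ampliate, trace_dyad_plainSetup]
    simpa using congrArg Complex.re this
  have hle (k) (hk : k ≠ i) : T.passProb Δ (Ξ k) i k ≤
      (T.J.card : ℝ)⁻¹ * ∑ m, (τ k m).trace.re := by
    rw [passProb, Finset.sum_comm]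
    have : ∑ m, ∑ j ∈ T.J ×ˢ T.J, (T.accepted Δ (Ξ k) i j k m).trace.re ≤
        T.J.card * ∑ m, (τ k m).trace.re := by
      rw [Finset.mul_sum]
      refine Finset.sum_le_sum fun m _ => ?_
      simp only [htr]
      exact T.sum_trace_checkOp_le hk (hτ k m)
    refine (mul_le_mul_of_nonneg_left this (by positivity)).trans_eq ?_
    field_simp
  calc ∑ k ∈ Finset.univ.erase i, T.passProb Δ (Ξ k) i k
      ≤ ∑ k ∈ Finset.univ.erase i, (T.J.card : ℝ)⁻¹ * ∑ m, (τ k m).trace.re :=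
        Finset.sum_le_sum fun k hk => hle k (Finset.ne_of_mem_erase hk)
    _ ≤ ∑ k, (T.J.card : ℝ)⁻¹ * ∑ m, (τ k m).trace.re :=
        Finset.sum_le_sum_of_subset_of_nonneg (Finset.erase_subset _ _) fun k _ _ =>
          mul_nonneg (by positivity) (Finset.sum_nonneg fun m _ =>
            (Complex.le_def.1 (hτ k m).trace_nonneg).1)
    _ = 1 / (T.J.card : ℝ) := by rw [← Finset.mul_sum, hsum, mul_one, one_div]

end WrongIndices

end QOTT

/-! ### Existence of one-time tables. -/

section Construction

/-- The multiplicity of an eigenvalue of a diagonal matrix. -/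
lemma finrank_eigenspace_diagonal {n : Type*} [Fintype n] [DecidableEq n] (w : n → ℂ) (μ : ℂ) :
    Module.finrank ℂ (Module.End.eigenspace (Matrix.toLin' (Matrix.diagonal w)) μ) =
      Fintype.card {i // w i = μ} := by
  have h : Module.End.eigenspace (Matrix.toLin' (Matrix.diagonal w)) μ =
      LinearMap.ker (Matrix.diagonal fun i => w i - μ).mulVecLin := by
    ext v
    rw [Module.End.mem_eigenspace_iff, LinearMap.mem_ker, Matrix.toLin'_apply,
      Matrix.mulVecLin_apply, funext_iff, funext_iff]
    refine forall_congr' fun i => ?_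
    simp [Matrix.mulVec_diagonal, sub_mul, sub_eq_zero]
  have h1 := LinearMap.finrank_range_add_finrank_ker (Matrix.diagonal fun i => w i - μ).mulVecLin
  have h2 := Matrix.rank_diagonal fun i => w i - μ
  rw [Matrix.rank] at h2
  rw [h2, ← h, Module.finrank_fintype_fun_eq_card] at h1
  have h3 := Fintype.card_subtype_compl fun i => w i - μ ≠ 0
  have h4 := Fintype.card_subtype_le fun i => w i - μ ≠ 0
  have h5 : Fintype.card {i // ¬ (w i - μ ≠ 0)} = Fintype.card {i // w i = μ} :=
    Fintype.card_congr (Equiv.subtypeEquivRight fun i => by simp [sub_eq_zero])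
  omega

/-- Extension of a matching of two embedded copies of `X` to all of `Y` and `Z`. -/
lemma exists_equiv_comp_eq {X Y Z : Type*} [Fintype Y] [Fintype Z]
    (e₁ : X ↪ Y) (e₂ : X ↪ Z) (h : Fintype.card Y = Fintype.card Z) :
    ∃ g : Y ≃ Z, ∀ x, g (e₁ x) = e₂ x := by
  classical
  have : Fintype X := Fintype.ofInjective e₁ e₁.injective
  rcases isEmpty_or_nonempty X with hX | ⟨⟨x₀⟩⟩
  · exact ⟨Fintype.equivOfCardEq h, fun x => isEmptyElim x⟩
  -- The default `e₂ x₀` is arbitrary: only the values of f on the range of `e₁` are used.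
  let f : Y → Z := Function.extend e₁ e₂ fun _ => e₂ x₀
  have hf (x) : f (e₁ x) = e₂ x := e₁.injective.extend_apply _ _ _
  obtain ⟨g, hg⟩ := Finset.exists_equiv_extend_of_card_eq (t := (Finset.univ : Finset Z))
    (s := Finset.univ.map e₁) (f := f) (by simp [h]) (by simp) (by
      intro y hy y' hy' hyy
      simp only [Finset.coe_map, Finset.coe_univ, Set.image_univ, Set.mem_range] at hy hy'
      obtain ⟨x, rfl⟩ := hy
      obtain ⟨x', rfl⟩ := hy'
      rw [hf, hf] at hyy
      rw [e₂.injective hyy])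
  refine ⟨g.trans (Equiv.subtypeUnivEquiv fun z => Finset.mem_univ z), fun x => ?_⟩
  rw [← hf]
  exact hg _ (by simp)

/-- The marginal of a code `c ↦ ∑ⱼ |f c j⟩|h c j⟩|j⟩` on the first system. -/
lemma sum_code_marginal {C K P Q : Type*} [Fintype C] [DecidableEq C] [Fintype K] [Fintype Q]
    [DecidableEq P] [DecidableEq Q] (f : C → K → P) (h : C → K → Q) (c₀ : C)
    (hh : ∀ j c c', h c j = h c' j → c = c')
    (hf : ∀ (c : C) (G : P → ℂ), ∑ j, G (f c j) = ∑ j, G (f c₀ j))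
    (ρ : Matrix C C ℂ) (x x' : P) :
    ∑ q, ∑ j, ∑ c, ∑ c', ρ c c' * (if x = f c j ∧ q = h c j then 1 else 0) *
      (if x' = f c' j ∧ q = h c' j then 1 else 0) =
      ρ.trace * ∑ j, (if x = f c₀ j then 1 else 0) * (if x' = f c₀ j then 1 else 0) := by
  -- Given j, the discarded system Q determines c, so coherences between different c are lost.
  have h1 (j c c') : ∑ q, ρ c c' * (if x = f c j ∧ q = h c j then 1 else 0) *
      (if x' = f c' j ∧ q = h c' j then 1 else 0) = if c = c' then
        ρ c c * ((if x = f c j then 1 else 0) * (if x' = f c j then 1 else 0)) else 0 := by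
    by_cases hc : c = c'
    · subst hc
      by_cases e1 : x = f c j <;> by_cases e2 : x' = f c j <;> simp [e1, e2]
    · rw [if_neg hc]
      refine Finset.sum_eq_zero fun q _ => ?_
      by_cases e1 : q = h c j
      · have e2 : ¬ q = h c' j := fun e2 => hc (hh j c c' (e1 ▸ e2))
        simp [e2]
      · simp [e1]
  calc _ = ∑ j, ∑ c, ∑ c', ∑ q, ρ c c' * (if x = f c j ∧ q = h c j then 1 else 0) *
      (if x' = f c' j ∧ q = h c' j then 1 else 0) := by
        rw [Finset.sum_comm]
        refine Finset.sum_congr rfl fun j _ => ?_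
        rw [Finset.sum_comm]
        refine Finset.sum_congr rfl fun c _ => ?_
        rw [Finset.sum_comm]
    _ = ∑ c, ρ c c * ∑ j, (if x = f c j then 1 else 0) * (if x' = f c j then 1 else 0) := by
        simp only [h1, Finset.sum_ite_eq, Finset.mem_univ, if_true]
        rw [Finset.sum_comm]
        simp only [Finset.mul_sum]
    _ = _ := by
        simp only [hf _ fun y => (if x = y then (1 : ℂ) else 0) * (if x' = y then 1 else 0)]
        rw [← Finset.sum_mul]
        rfl

variable {C A B S : Type*}

/-- The permutation matrix of `g`. -/
noncomputable def permUnitary [DecidableEq C] [DecidableEq S] (g : C × S ≃ A × B) : Matrix (A × B) (C × S) ℂ :=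
  (1 : Matrix (C × S) (C × S) ℂ).submatrix g.symm id

lemma conjTranspose_permUnitary_mul_self [Fintype A] [Fintype B] [DecidableEq C] [DecidableEq S]
    (g : C × S ≃ A × B) : (permUnitary g)ᴴ * permUnitary g = 1 := by
  have := Fintype.ofEquiv _ g.symm
  ext x y
  rw [Matrix.mul_apply, ← g.sum_comp]
  simp [permUnitary, Matrix.one_apply, eq_comm]

lemma permUnitary_mul_mul [Fintype C] [Fintype S] [DecidableEq C] [DecidableEq S]
    (g : C × S ≃ A × B) (σ : Matrix (C × S) (C × S) ℂ) :
    permUnitary g * σ * (permUnitary g)ᴴ = σ.submatrix g.symm g.symm := by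
  ext x y
  simp [permUnitary, Matrix.mul_apply, Matrix.one_apply]

/-- Undoing `permUnitary g` and discarding the safe system. -/
noncomputable def unmask [Fintype S] (g : C × S ≃ A × B) :
    Matrix (A × B) (A × B) ℂ →ₗ[ℂ] Matrix C C ℂ where
  toFun σ := ∑ s, σ.submatrix (fun c => g (c, s)) (fun c => g (c, s))
  map_add' σ τ := by ext; simp [Matrix.sum_apply, Finset.sum_add_distrib]
  map_smul' c σ := by ext; simp [Matrix.sum_apply, Finset.mul_sum]

lemma isChannel_unmask [Fintype C] [Fintype A] [Fintype B] [Fintype S]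
    (g : C × S ≃ A × B) : IsChannel (unmask g) := by
  constructor
  · intro n σ hσ
    have : ampliate (unmask g) σ = ∑ s, σ.submatrix
        (fun y : C × Fin n => (g (y.1, s), y.2)) (fun y => (g (y.1, s), y.2)) := by
      ext y y'
      simp [ampliate, unmask, Matrix.sum_apply]
    rw [this]
    exact Matrix.posSemidef_sum _ fun s _ => hσ.submatrix _
  · intro ρ
    rw [Matrix.trace, Matrix.trace, ← g.sum_comp, Fintype.sum_prod_type]
    simp [unmask, Matrix.sum_apply]

/-- The flat state on the image of an embedding. -/
noncomputable def flatState [DecidableEq S] {p : ℕ} (e : ZMod p ↪ S) : Matrix S S ℂ :=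
  open Classical in
  Matrix.diagonal fun s => if s ∈ Set.range e then (p : ℂ)⁻¹ else 0

variable {p : ℕ} [Fact p.Prime] [DecidableEq S]

lemma flatState_apply (e : ZMod p ↪ S) (s s' : S) :
    flatState e s s' =
      (p : ℂ)⁻¹ * ∑ j, (if s = e j then 1 else 0) * (if s' = e j then 1 else 0) := by
  classical
  rw [flatState, Matrix.diagonal_apply]
  by_cases hs : s ∈ Set.range e
  · obtain ⟨j, rfl⟩ := hs
    rw [Finset.sum_eq_single j (fun k _ hk => by simp [hk.symm]) (by simp)]
    simp [eq_comm]
  · rw [Finset.sum_eq_zero fun j _ => by rw [if_neg fun h => hs ⟨j, h.symm⟩, zero_mul]]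
    simp [hs]

lemma isDensity_flatState [Fintype S] (e : ZMod p ↪ S) : IsDensity (flatState e) := by
  classical
  have hp : (p : ℂ) ≠ 0 := Nat.cast_ne_zero.2 (Fact.out : p.Prime).ne_zero
  constructor
  · refine Matrix.PosSemidef.diagonal fun s => ?_
    dsimp only [Pi.zero_apply]
    split_ifs
    · simp
    · rfl
  · simp only [Matrix.trace, Matrix.diag_apply, flatState_apply, ← Finset.mul_sum]
    rw [Finset.sum_comm]
    simp [ZMod.card, hp]

lemma permUnitary_mul_flatState_apply {d : ℕ} [NeZero d] [DecidableEq A] [DecidableEq B]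
    [Fintype S] (g : ZMod d × S ≃ A × B)
    (e : ZMod p ↪ S) (ρ : Matrix (ZMod d) (ZMod d) ℂ) (x y : A × B) :
    (permUnitary g * (ρ ⊗ₖ flatState e) * (permUnitary g)ᴴ) x y = (p : ℂ)⁻¹ *
      ∑ j, ∑ c, ∑ c', ρ c c' * (if x = g (c, e j) then 1 else 0) *
        (if y = g (c', e j) then 1 else 0) := by
  have h (z : A × B) (c : ZMod d) (s : S) :
      z = g (c, s) ↔ (g.symm z).1 = c ∧ (g.symm z).2 = s := by
    rw [← Equiv.symm_apply_eq, Prod.ext_iff]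
  rw [permUnitary_mul_mul, Matrix.submatrix_apply, Matrix.kroneckerMap_apply, flatState_apply,
    mul_left_comm, Finset.mul_sum]
  congr 1
  refine Finset.sum_congr rfl fun j _ => ?_
  simp only [h, ite_and, mul_ite, mul_one, mul_zero, Finset.sum_ite_irrel, Finset.sum_ite_eq,
    Finset.mem_univ, if_true, Finset.sum_const_zero]

end Construction

/-- The one-time table of the code `c ↦ ∑ⱼ |j+c⟩|j+2c⟩|j⟩`. -/
lemma exists_qott (d p : ℕ) [NeZero d] [Fact p.Prime] (hd : d ≤ p) (hp3 : 3 ≤ p) :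
    ∃ (a b s : ℕ) (T : QOTT d p (Fin a) (Fin b) (Fin s)), T.J.card = p - 1 := by
  classical
  have hp : (p : ℂ) ≠ 0 := Nat.cast_ne_zero.2 (Fact.out : p.Prime).ne_zero
  have hdpos : 0 < d := Nat.pos_of_ne_zero (NeZero.ne d)
  have hemb (n : ℕ) (hn : p ≤ n) : Nonempty (ZMod p ↪ Fin n) :=
    Function.Embedding.nonempty_of_card_le (by simpa [ZMod.card] using hn)
  -- The sizes pd, p and p² of A, B and S make dim A · dim B = dim C · dim S, so that the code
  -- extends to a unitary.
  obtain ⟨eA⟩ := hemb (p * d) (Nat.le_mul_of_pos_right p hdpos)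
  obtain ⟨eB⟩ := hemb p le_rfl
  obtain ⟨eS⟩ := hemb (p * p) (Nat.le_mul_of_pos_right p (by omega))
  let φ : ZMod d → ZMod p := fun c => (c.val : ZMod p)
  have hφ : Function.Injective φ := fun c c' h => by
    have h1 := congrArg ZMod.val h
    simp only [φ] at h1
    rw [ZMod.val_cast_of_lt ((ZMod.val_lt c).trans_le hd),
      ZMod.val_cast_of_lt ((ZMod.val_lt c').trans_le hd)] at h1
    exact ZMod.val_injective d h1
  -- With p odd, j + 2c determines c once j is known, as j + c does; both marginals need this.
  have h2 : (2 : ZMod p) ≠ 0 := by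
    intro h
    have : ((2 : ℕ) : ZMod p) = 0 := by exact_mod_cast h
    rw [ZMod.natCast_eq_zero_iff] at this
    exact absurd (Nat.le_of_dvd two_pos this) (by omega)
  have hA (j : ZMod p) (c c' : ZMod d) (h : eA (j + φ c) = eA (j + φ c')) : c = c' :=
    hφ (add_left_cancel (eA.injective h))
  have hB (j : ZMod p) (c c' : ZMod d) (h : eB (j + 2 * φ c) = eB (j + 2 * φ c')) : c = c' :=
    hφ (mul_left_cancel₀ h2 (add_left_cancel (eB.injective h)))
  let e₁ : ZMod d × ZMod p ↪ ZMod d × Fin (p * p) :=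
    ⟨fun x => (x.1, eS x.2), fun x y h => by
      simp only [Prod.mk.injEq, EmbeddingLike.apply_eq_iff_eq] at h
      exact Prod.ext h.1 h.2⟩
  -- The difference of the two labels recovers c, and then the first recovers j.
  let e₂ : ZMod d × ZMod p ↪ Fin (p * d) × Fin p :=
    ⟨fun x => (eA (x.2 + φ x.1), eB (x.2 + 2 * φ x.1)), fun x y h => by
      simp only [Prod.mk.injEq, EmbeddingLike.apply_eq_iff_eq] at h
      have h3 : φ x.1 = φ y.1 := by linear_combination h.2 - h.1
      have h4 : x.2 = y.2 := by linear_combination h.1 - h3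
      exact Prod.ext (hφ h3) h4⟩
  obtain ⟨g, hg⟩ := exists_equiv_comp_eq e₁ e₂ (by simp [ZMod.card]; ring)
  have hg' (c : ZMod d) (j : ZMod p) : g (c, eS j) = (eA (j + φ c), eB (j + 2 * φ c)) :=
    hg (c, j)
  have hshift (c : ZMod p) (G : ZMod p → ℂ) : ∑ j, G (j + c) = ∑ j, G j :=
    Equiv.sum_comp (Equiv.addRight c) G
  have hentry (ρ : Matrix (ZMod d) (ZMod d) ℂ) (x y) := permUnitary_mul_flatState_apply g eS ρ x y
  simp only [hg', Prod.ext_iff] at hentry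
  refine ⟨p * d, p, p * p,
    { M := permUnitary g
      safe := flatState eS
      Ω := fun x => if x.1 = eS x.2 then ((Real.sqrt p : ℝ) : ℂ)⁻¹ else 0
      J := Finset.univ.erase 0
      isometry := conjTranspose_permUnitary_mul_self g
      coisometry := by simpa using permUnitary_mul_mul g 1
      safe_density := isDensity_flatState eS
      safe_eigenvalues := fun μ hμ => ?_
      safe_degeneracy := ?_
      masks := ⟨⟨Matrix.of fun x x' => (p : ℂ)⁻¹ * ∑ j, (if x = eA (j + φ 0) then 1 else 0) *
          (if x' = eA (j + φ 0) then 1 else 0), fun ρ hρ => ?_⟩,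
        ⟨Matrix.of fun x x' => (p : ℂ)⁻¹ * ∑ j, (if x = eB (j + 2 * φ 0) then 1 else 0) *
          (if x' = eB (j + 2 * φ 0) then 1 else 0), fun ρ hρ => ?_⟩,
        ⟨unmask g, isChannel_unmask g, fun ρ _ => ?_⟩⟩
      purifies := ?_
      zero_notMem := by simp
      two_le_card := ?_ }, ?_⟩
  · rw [flatState, hasEigenvalue_toLin'_diagonal_iff] at hμ
    obtain ⟨s, hs⟩ := hμ
    split_ifs at hs
    · exact .inr hs.symm
    · exact .inl hs.symm
  · rw [flatState, finrank_eigenspace_diagonal]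
    refine (Fintype.card_congr ((Equiv.subtypeEquivRight fun s => ?_).trans
      (Equiv.ofInjective eS eS.injective).symm)).trans (ZMod.card p)
    by_cases h : s ∈ Set.range eS <;> simp [h, hp.symm]
  · ext x x'
    simp only [ptrRight, Matrix.of_apply, hentry, ← Finset.mul_sum]
    -- Discarding B removes coherences in c, and uniformity of j hides the shift by c.
    rw [sum_code_marginal (fun c j => eA (j + φ c)) (fun c j => eB (j + 2 * φ c)) 0 hB
      (fun c G => by rw [hshift (φ c) fun j => G (eA j), hshift (φ 0) fun j => G (eA j)]),
      hρ.2, one_mul]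
  · ext x x'
    simp only [ptrLeft, Matrix.of_apply, hentry, ← Finset.mul_sum, and_comm (b := x = _),
      and_comm (b := x' = _)]
    rw [sum_code_marginal (fun c j => eB (j + 2 * φ c)) (fun c j => eA (j + φ c)) 0 hA
      (fun c G => by
        rw [hshift (2 * φ c) fun j => G (eB j), hshift (2 * φ 0) fun j => G (eB j)]),
      hρ.2, one_mul]
  · ext c c'
    have h := (isDensity_flatState eS).2
    rw [Matrix.trace] at h
    simp only [unmask, permUnitary_mul_mul, LinearMap.coe_mk, AddHom.coe_mk, Matrix.sum_apply,
      Matrix.submatrix_apply, Equiv.symm_apply_apply, Matrix.kroneckerMap_apply]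
    rw [← Finset.mul_sum]
    exact (congrArg _ h).trans (mul_one _)
  · ext s s'
    rw [flatState_apply, ← sqrt_mul_sqrt_natCast, Finset.mul_sum]
    simp only [ptrRight, Matrix.of_apply, dyad_apply]
    refine Finset.sum_congr rfl fun j _ => ?_
    by_cases h1 : s = eS j <;> by_cases h2 : s' = eS j <;> simp [h1, h2]
  · rw [Finset.card_erase_of_mem (Finset.mem_univ _), Finset.card_univ, ZMod.card]
    omega
  · rw [Finset.card_erase_of_mem (Finset.mem_univ _), Finset.card_univ, ZMod.card]

/-- There are one-time tables with arbitrarily small threshold. -/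
lemma exists_qott_card_lt (d : ℕ) [NeZero d] {ε : ℝ} (hε : 0 < ε) :
    ∃ (p : ℕ) (_ : Fact p.Prime) (a b s : ℕ)
      (T : QOTT d p (Fin a) (Fin b) (Fin s)), 1 / (T.J.card : ℝ) < ε := by
  obtain ⟨n, hn⟩ := exists_nat_gt (1 / ε)
  -- The summands ensure d ≤ p, p - 1 ≥ n and p ≥ 3 respectively.
  obtain ⟨p, hp, hpp⟩ := Nat.exists_infinite_primes (d + n + 3)
  have : Fact p.Prime := ⟨hpp⟩
  obtain ⟨a, b, s, T, hT⟩ := exists_qott d p (by omega) (by omega)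
  refine ⟨p, this, a, b, s, T, ?_⟩
  have h : (n : ℝ) ≤ T.J.card := by rw [hT]; exact_mod_cast (by omega : n ≤ p - 1)
  rw [one_div, inv_lt_comm₀ (by have := one_div_pos.2 hε; linarith) hε, ← one_div]
  linarith

end QC

/-! ### The security theorem. -/

theorem theorem2 (d : ℕ) [NeZero d] :
    (∀ (p : ℕ) [Fact p.Prime] (A B S : Type*) [Fintype A] [DecidableEq A] [Fintype B]
        [DecidableEq B] [Fintype S] [DecidableEq S] (T : QC.QOTT d p A B S),
      -- correctness
      (∀ ρ, QC.IsDensity ρ → ∀ i : ZMod p × ZMod p, ∀ j ∈ T.J ×ˢ T.J, ∀ m,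
        T.accepted (QC.honestCommit ρ) LinearMap.id i j i m = ((d : ℂ) ^ 2)⁻¹ • ρ) ∧
      -- perfect concealment against Bob
      (∃ β : Matrix B B ℂ, QC.IsDensity β ∧
        ∀ ρ, QC.IsDensity ρ → ∀ j ∈ T.J ×ˢ T.J, ∀ m,
          T.bobView ρ j m =
            ((d : ℂ) ^ 2)⁻¹ • Matrix.kronecker β ((p : ℂ)⁻¹ • (1 : Matrix (ZMod p) (ZMod p) ℂ))) ∧
      -- security against Alice
      (∃ (r : ℕ) (Ψ : A × Fin r → ℂ), (QC.dyad Ψ).trace = 1 ∧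
        -- after an honest commitment to `ρ`, with the true indices reported
        (∀ ρ, QC.IsDensity ρ → ∀ Ξ : Matrix A A ℂ →ₗ[ℂ] Matrix A A ℂ, QC.IsChannel Ξ →
          ∀ i : ZMod p × ZMod p, ∀ j ∈ T.J ×ˢ T.J, ∀ m,
            T.accepted (QC.honestCommit ρ) Ξ i j i m =
              (((d : ℂ) ^ 2)⁻¹ *
                (star Ψ ⬝ᵥ Matrix.mulVec (QC.ampliate Ξ (QC.dyad Ψ)) Ψ)) • ρ) ∧
        -- arbitrary behaviour of Alice; `Ξ k` accompanies the report `k`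
        (∀ (A' : Type*) [Fintype A']
          (Δ : ZMod d × ZMod d →
            (Matrix (ZMod d × A) (ZMod d × A) ℂ →ₗ[ℂ] Matrix A' A' ℂ))
          (Ξ : ZMod p × ZMod p → (Matrix A' A' ℂ →ₗ[ℂ] Matrix A A ℂ)),
          QC.IsInstrument Δ → QC.IsInstrument Ξ →
          ∀ i : ZMod p × ZMod p,
            -- true indices: the output is that of delayed quantum teleportation
            (∀ j ∈ T.J ×ˢ T.J, ∀ m,
              T.accepted Δ (Ξ i) i j i m = QC.delayedTeleportation Ψ Δ (Ξ i) Ψ m) ∧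
            -- wrong indices: the probability of passing the check
            ∑ k ∈ Finset.univ.erase i, T.passProb Δ (Ξ k) i k ≤ 1 / (T.J.card : ℝ)))) ∧
    -- the threshold can be made arbitrarily small
    (∀ ε : ℝ, 0 < ε → ∃ (p : ℕ) (_ : Fact p.Prime) (a b s : ℕ)
      (T : QC.QOTT d p (Fin a) (Fin b) (Fin s)), 1 / (T.J.card : ℝ) < ε) := by
  refine ⟨fun p _ A B S _ _ _ _ _ _ T => ?_, fun ε hε => QC.exists_qott_card_lt d hε⟩
  obtain ⟨r, Ψ, U, hU, hT⟩ := T.exists_dilation_factor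
  have hΨ := T.trace_dyad_ancilla hU hT
  have honest (ρ : Matrix (ZMod d) (ZMod d) ℂ) (Ξ : Matrix A A ℂ →ₗ[ℂ] Matrix A A ℂ)
      (i j : ZMod p × ZMod p) (m : ZMod d × ZMod d) :=
    (T.accepted_self_eq_delayedTeleportation hU hT (QC.honestCommit ρ) Ξ i j m).trans
      (QC.delayedTeleportation_honestCommit Ψ ρ Ξ m)
  refine ⟨fun ρ _ i j _ m => ?_, ?_, r, Ψ, hΨ, fun ρ _ Ξ _ i j _ m => honest ρ Ξ i j m,
    fun A' _ Δ Ξ hΔ hΞ i => ⟨fun j _ m =>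
      T.accepted_self_eq_delayedTeleportation hU hT Δ (Ξ i) i j m, T.sum_passProb_le hΔ hΞ i⟩⟩
  -- Correctness is the case Ξ = id, where q = 1 because Ψ is a unit vector.
  · rw [honest, QC.ampliate_id, QC.star_dotProduct_dyad_mulVec, hΨ, mul_one, mul_one]
  · obtain ⟨β, hβ, h⟩ := T.exists_density_ptrLeft_mask
    exact ⟨β, hβ, fun ρ hρ j hj m => T.bobView_eq h hρ hj m⟩
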